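/- For a matrix $H\in\mathbb F_2^{m\times n}$ (whose rows are the checks of the code $C=\ker H$) say that $H$ is LDPC with locality $w$ if every row and every column of $H$ has weight at most $w$, and that $C$ is locally testable through $H$ with soundness $\rho$ if $\frac1m|Hx|\ge\frac{\rho}{n}\,d(x,C)$ for all $x\in\mathbb F_2^n$, where $d(x,C)$ is the Hamming distance from $x$ to $C$. For a CSS code $Q=\mathrm{css}(H_X,H_Z)$ on $N$ qubits, with stabilizer generators $S_1,\dots,S_M$ (an operator $X^r$ for each row $r$ of $H_X$, an operator $Z^r$ for each row $r$ of $H_Z$), say that $Q$ is a quantum locally testable code with soundness $\rho$ and check weight $b$ if all generators have weight at most $b$ and $$\frac1M\sum_{i=1}^M\tfrac12(I-S_i)\succeq\frac{\rho}{N}\,D_Q,\qquad D_Q=\sum_{t\ge1}t\,(\Pi_{Q_t}-\Pi_{Q_{t-1}}),$$ where $Q_t$ is the span of all $(A_1\otimes\cdots\otimes A_N)|\psi\rangle$ with $|\psi\rangle$ in the code space and at most $t$ of the factors $A_i$ different from $I$, and $\Pi_{Q_t}$ is the orthogonal projector onto $Q_t$. For $\ell\ge2$ let $E=\mathbb F_2^{\ell-1}$,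 $V=\mathbb F_2^{\ell}$, and let $B:E\to V$ be the incidence matrix of the star graph with $\ell$ vertices and $\ell-1$ edges ($Be_i=v_i+v_\ell$). Let $Q_\ell(H)$ be the distance balancing by $B$ of the gauge-fixed code $\mathrm{css}([H,H],[I,I])$: it is the CSS code read off from the three lowest degrees of the product of the complexes $\mathbb F_2^n\xrightarrow{[I,I]^T}\mathbb F_2^{2n}\xrightarrow{[H,H]}\mathbb F_2^m$ and $E\xrightarrow{B}V$, with qubits $(\mathbb F_2^{2n}\otimes V)\oplus(\mathbb F_2^m\otimes E)$, $X$-generators given by $\mathbb F_2^m\otimes V$, and $Z$-generators given by $(\mathbb F_2^{2n}\otimes E)\oplus(\mathbb F_2^n\otimes V)$. **Theorem.** There is an absolute constant $c_0>0$, and for every $w$ there are constants $c>0$ and $K\in\mathbb N$ depending only on $w$, such that the following holds for every integer $\ell\ge2$, every $\rho>0$ and every LDPC matrix $H\in\mathbb F_2^{m\times n}$ of locality $w$ for which $C=\ker H$ has parameters $[n,k,d]$ (so $C\neq 0$ and $d$ is its minimum distance) and is locally testable through $H$ with soundness $\rho$. 1. $Q_\ell(H)$ has parameters $[N,\,k,\,\min(d,2\ell)]$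 with $N=2n\ell+m(\ell-1)$: it has $N$ physical qubits, a code space of dimension $2^k$, and minimum distance $\min(d,2\ell)$. 2. If $d\ge2$, then $Q_\ell(H)$ is a quantum locally testable code with soundness $c\rho$ and check weight $K\ell$. Moreover, for every $d\ge1$ and with absolute constants, its two classical component codes are locally testable with check weight $K\ell$: the kernel of its $X$-check matrix with soundness $c_0\min(\rho,1)$, and the kernel of its $Z$-check matrix with soundness $c_0$. 3. There is a set of exactly a $1/\ell$ fraction of the $X$-generators such that each generator in it has weight between $\ell/K$ and $K\ell$, and each $X$-generator outside it has weight at most $K$. Every $Z$-generator has weight at most $K$. 4. There is a set of at most a $1/\ell$ fraction of the qubits such that each qubit in it is in between $\ell/K$ and $K\ell$ of the $Z$-generators, and each qubit outside it is in at most $K$ of the $Z$-generators. Every qubit is in at most $K$ of the $X$-generators. -/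

import Mathlib

open scoped Kronecker

noncomputable section

/-! ### Classical binary linear codes -/

/-- The code `ker H` with parity-check matrix `H`; the rows of `H` are the checks. -/
def kerCode {M ι : Type*} [Fintype ι] (H : Matrix M ι (ZMod 2)) :
    Submodule (ZMod 2) (ι → ZMod 2) :=
  LinearMap.ker H.mulVecLin

/-- The Hamming distance from a word to a code. -/
def distTo {ι : Type*} [Fintype ι] (x : ι → ZMod 2) (C : Submodule (ZMod 2) (ι → ZMod 2)) : ℕ :=
  sInf {t | ∃ c ∈ C, hammingDist x c = t}

/-- The dual code `C^⊥`. -/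
def dualCode {ι : Type*} [Fintype ι] (C : Submodule (ZMod 2) (ι → ZMod 2)) :
    Submodule (ZMod 2) (ι → ZMod 2) where
  carrier := {x | ∀ c ∈ C, x ⬝ᵥ c = 0}
  add_mem' := by
    intro a b ha hb c hc
    rw [add_dotProduct, ha c hc, hb c hc, add_zero]
  zero_mem' := by
    intro c _
    exact zero_dotProduct c
  smul_mem' := by
    intro r a ha c hc
    rw [smul_dotProduct, ha c hc, smul_zero]

/-- The code `C` has parameters `[n, k, d]`: block length `n`, dimension `k`, and minimum
distance `d`. (A minimum distance exists only when `C` has a nonzero codeword.) -/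
def HasParams {ι : Type*} [Fintype ι] (C : Submodule (ZMod 2) (ι → ZMod 2)) (n k d : ℕ) : Prop :=
  Fintype.card ι = n ∧ Module.finrank (ZMod 2) C = k ∧
    IsLeast {t | ∃ c ∈ C, c ≠ 0 ∧ hammingNorm c = t} d

/-- The weight of check `i`: the number of bits it involves. -/
def rowWeight {M ι : Type*} [Fintype ι] (H : Matrix M ι (ZMod 2)) (i : M) : ℕ :=
  hammingNorm (H i)

/-- The degree of bit `j`: the number of checks that involve it. -/
def colWeight {M ι : Type*} [Fintype M] (H : Matrix M ι (ZMod 2)) (j : ι) : ℕ :=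
  hammingNorm (fun i => H i j)

/-- Low density with locality `w`: every check involves at most `w` bits, and every bit is
involved in at most `w` checks. -/
def IsLDPC {M ι : Type*} [Fintype M] [Fintype ι] (H : Matrix M ι (ZMod 2)) (w : ℕ) : Prop :=
  (∀ i, rowWeight H i ≤ w) ∧ ∀ j, colWeight H j ≤ w

/-- `ker H` is locally testable, through the checks of `H`, with soundness `ρ` and check weight
(at most) `w`. -/
def IsLTC {M ι : Type*} [Fintype M] [Fintype ι] (H : Matrix M ι (ZMod 2)) (ρ : ℝ) (w : ℕ) : Prop :=
  (∀ i, rowWeight H i ≤ w) ∧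
    ∀ x : ι → ZMod 2, ρ / (Fintype.card ι : ℝ) * (distTo x (kerCode H) : ℝ) ≤
      (hammingNorm (H.mulVec x) : ℝ) / (Fintype.card M : ℝ)

/-! ### Qubits, Pauli operators, CSS codes -/

/-- The Hilbert space of qubits indexed by `ι`: the orthonormal computational basis is indexed by
`ι → Fin 2`. -/
abbrev Qubits (ι : Type*) [Fintype ι] : Type _ := EuclideanSpace ℂ (ι → Fin 2)

/-- The operator `⨂ i, A i`. -/
def tensorOp {ι : Type*} [Fintype ι] [DecidableEq ι] (A : ι → Matrix (Fin 2) (Fin 2) ℂ) :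
    Qubits ι →L[ℂ] Qubits ι :=
  Matrix.toEuclideanCLM (n := ι → Fin 2) (𝕜 := ℂ)
    (Matrix.of fun b b' => ∏ i, A i (b i) (b' i))

/-- The Pauli operator `X^v`. -/
def pauliX {ι : Type*} [Fintype ι] [DecidableEq ι] (v : ι → ZMod 2) : Qubits ι →L[ℂ] Qubits ι :=
  tensorOp fun i => if v i = 0 then 1 else !![0, 1; 1, 0]

/-- The Pauli operator `Z^v`. -/
def pauliZ {ι : Type*} [Fintype ι] [DecidableEq ι] (v : ι → ZMod 2) : Qubits ι →L[ℂ] Qubits ι :=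
  tensorOp fun i => if v i = 0 then 1 else !![1, 0; 0, -1]

/-- The data `css(H_X, H_Z)` on qubits indexed by `ι`: the rows `r` of `H_X` give the
`X`-stabilizer generators `X^r`, the rows of `H_Z` the `Z`-stabilizer generators `Z^r`. -/
structure CSSCode (MX MZ ι : Type*) [Fintype ι] where
  hX : Matrix MX ι (ZMod 2)
  hZ : Matrix MZ ι (ZMod 2)
  comm : hX * hZ.transpose = 0

namespace CSSCode

variable {MX MZ ι : Type*} [Fintype ι]

/-- The stabilizer generators. -/
def generator [DecidableEq ι] (Q : CSSCode MX MZ ι) : MX ⊕ MZ → (Qubits ι →L[ℂ] Qubits ι)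
  | Sum.inl i => pauliX (Q.hX i)
  | Sum.inr j => pauliZ (Q.hZ j)

/-- The weights of the stabilizer generators. -/
def generatorWeight (Q : CSSCode MX MZ ι) : MX ⊕ MZ → ℕ
  | Sum.inl i => rowWeight Q.hX i
  | Sum.inr j => rowWeight Q.hZ j

/-- The code space: the states fixed by all stabilizer generators. -/
def codeSpace [DecidableEq ι] (Q : CSSCode MX MZ ι) : Submodule ℂ (Qubits ι) where
  carrier := {ψ | ∀ s, Q.generator s ψ = ψ}
  add_mem' := by
    intro a b ha hb s
    rw [map_add, ha s, hb s]
  zero_mem' := fun s => map_zero _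
  smul_mem' := by
    intro r a ha s
    rw [map_smul, ha s]

/-- The weights of the nontrivial logical operators of `X`- and of `Z`-type. -/
def logicalWeights (Q : CSSCode MX MZ ι) : Set ℕ :=
  {t | ∃ c ∈ kerCode Q.hX, c ∉ dualCode (kerCode Q.hZ) ∧ hammingNorm c = t} ∪
    {t | ∃ c ∈ kerCode Q.hZ, c ∉ dualCode (kerCode Q.hX) ∧ hammingNorm c = t}

/-- The quantum code has parameters `[n, k, d]`: `n` physical qubits, `k` logical qubits (a code
space of dimension `2 ^ k`), and minimum distance `d`. -/
def HasParams [DecidableEq ι] (Q : CSSCode MX MZ ι) (n k d : ℕ) : Prop :=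
  Fintype.card ι = n ∧ Module.finrank ℂ Q.codeSpace = 2 ^ k ∧ IsLeast Q.logicalWeights d

end CSSCode

/-! ### Quantum local testability -/

/-- The `t`-fattening of a subspace: the span of all `(⨂ i, A i) ψ` with `ψ` in the subspace and
at most `t` factors `A i` different from the identity. -/
def fattening {ι : Type*} [Fintype ι] [DecidableEq ι] (S : Submodule ℂ (Qubits ι)) (t : ℕ) :
    Submodule ℂ (Qubits ι) :=
  Submodule.span ℂ {φ | ∃ A : ι → Matrix (Fin 2) (Fin 2) ℂ,
    Set.ncard {i | A i ≠ 1} ≤ t ∧ ∃ ψ ∈ S, tensorOp A ψ = φ}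

/-- The operator `D = ∑ t ≥ 1, t (Π_t - Π_{t-1})`, with `Π_t` the orthogonal projector onto the
`t`-fattening; the terms with `t` larger than the number of qubits vanish. -/
def distanceOp {ι : Type*} [Fintype ι] [DecidableEq ι] (S : Submodule ℂ (Qubits ι)) :
    Qubits ι →L[ℂ] Qubits ι :=
  ∑ t ∈ Finset.Icc 1 (Fintype.card ι),
    (t : ℂ) • ((fattening S t).starProjection - (fattening S (t - 1)).starProjection)

/-- The quantum code is locally testable, through its stabilizer generators `S₁, …, S_M`, with
soundness `ρ` and check weight `w`: all generators have weight at most `w`, and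
`(1/M) ∑ (I - S_i)/2 - (ρ/n) D` is a positive semidefinite operator. -/
def CSSCode.IsQLTC {MX MZ ι : Type*} [Fintype MX] [Fintype MZ] [Fintype ι] [DecidableEq ι]
    (Q : CSSCode MX MZ ι) (ρ : ℝ) (w : ℕ) : Prop :=
  (∀ s, Q.generatorWeight s ≤ w) ∧
    ((1 / (Fintype.card (MX ⊕ MZ) : ℂ)) • ∑ s, (1 / 2 : ℂ) • (1 - Q.generator s)
      - ((ρ / (Fintype.card ι : ℝ) : ℝ) : ℂ) • distanceOp Q.codeSpace).IsPositive

/-! ### The construction -/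

/-- The gauge-fixed code `css([H, H], [I, I])`. -/
def gaugeFixed {M ι : Type*} [Fintype ι] [DecidableEq ι]
    (H : Matrix M ι (ZMod 2)) : CSSCode M ι (ι ⊕ ι) where
  hX := Matrix.fromCols H H
  hZ := Matrix.fromCols 1 1
  comm := by
    rw [Matrix.transpose_fromCols, Matrix.fromCols_mul_fromRows]
    simp only [Matrix.transpose_one, Matrix.mul_one]
    ext i j
    exact CharTwo.add_self_eq_zero _

/-- Distance balancing: the homological product of the complex
`𝔽₂^MZ → 𝔽₂^ι → 𝔽₂^MX` (maps `H_Zᵀ`, `H_X`) with the complex `𝔽₂^E → 𝔽₂^V` (map `B`), cut to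
its three lowest degrees: the qubits are `(ι × V) ⊕ (MX × E)`, the `X`-generators `MX × V`, and
the `Z`-generators `(ι × E) ⊕ (MZ × V)`. -/
def distanceBalance {MX MZ ι V E : Type*} [Fintype MX] [DecidableEq MX] [DecidableEq MZ]
    [Fintype ι] [DecidableEq ι] [Fintype V] [DecidableEq V] [Fintype E] [DecidableEq E]
    (Q : CSSCode MX MZ ι) (B : Matrix V E (ZMod 2)) :
    CSSCode (MX × V) ((ι × E) ⊕ (MZ × V)) ((ι × V) ⊕ (MX × E)) where
  hX := Matrix.fromCols (Q.hX ⊗ₖ (1 : Matrix V V (ZMod 2))) ((1 : Matrix MX MX (ZMod 2)) ⊗ₖ B)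
  hZ := Matrix.fromBlocks
    ((1 : Matrix ι ι (ZMod 2)) ⊗ₖ B.transpose) (Q.hX.transpose ⊗ₖ (1 : Matrix E E (ZMod 2)))
    (Q.hZ ⊗ₖ (1 : Matrix V V (ZMod 2))) 0
  comm := by
    rw [Matrix.fromBlocks_transpose, Matrix.fromCols_mul_fromBlocks]
    simp only [← Matrix.kroneckerMap_transpose, Matrix.transpose_transpose, Matrix.transpose_one,
      ← Matrix.mul_kronecker_mul, Matrix.mul_one, Matrix.one_mul, Q.comm, Matrix.transpose_zero,
      Matrix.mul_zero, Matrix.zero_kronecker, add_zero]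
    ext i (j | j)
    · exact CharTwo.add_self_eq_zero _
    · rfl

/-- The vertex-edge incidence matrix of the star graph with `ℓ` vertices, the last vertex being
the centre: edge `e` joins vertex `e` to vertex `ℓ - 1`. -/
def starMatrix (ℓ : ℕ) : Matrix (Fin ℓ) (Fin (ℓ - 1)) (ZMod 2) :=
  Matrix.of fun v e => if v.val = e.val ∨ v.val = ℓ - 1 then 1 else 0

/-- The star-graph distance balancing of the gauge-fixed code `css([H, H], [I, I])`. -/
def starBalanced {n m : ℕ} (H : Matrix (Fin m) (Fin n) (ZMod 2)) (ℓ : ℕ) :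
    CSSCode (Fin m × Fin ℓ)
      (((Fin n ⊕ Fin n) × Fin (ℓ - 1)) ⊕ (Fin n × Fin ℓ))
      (((Fin n ⊕ Fin n) × Fin ℓ) ⊕ (Fin m × Fin (ℓ - 1))) :=
  distanceBalance (gaugeFixed H) (starMatrix ℓ)

end

open scoped Kronecker

noncomputable section

/-! ### Hamming weights -/

section Hamming

variable {α β M : Type*} [Fintype α] [Fintype β]

/-! A word on the qubits consists of two halves of length n at each of the ℓ vertices of the star
and a block of length m at each edge. An edge block enters the X-checks of exactly its two ends, so
adding the X-syndromes over all vertices cancels the edges (`mulVec_total`): the sum `total` of all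
halves has an H-syndrome no heavier than the X-syndrome of the word. A word satisfying the Z-checks
has equal halves, and its vertex blocks differ from one another only by elements of the row space of
H. Hence the pairing of the two kernels sees only the total of one word and the centre block of the
other (`dotProduct_eq_total_dotProduct`).

Parameters: a nontrivial logical word in the kernel of the X-checks has a nonzero codeword of C as
its total, so weight at least d; one in the kernel of the Z-checks is nonzero in both halves at
every vertex, so weight at least 2ℓ. Modulo X-generators, the kernel of the Z-checks is the quotient
of 𝔽₂ⁿ by the row space of H, of dimension k (`finrank_codeSpace`).

Classical soundness: X-syndromes at the leaves are repaired on the edge qubits, which leaves one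
instance of decoding C at the centre (`exists_distTo_hX_le`). Z-syndromes are repaired directly on
the vertex qubits, whatever H is (`distTo_hZ_le`).

Quantum soundness: the generators commute, so a state splits orthogonally by syndrome, and the
energy of a component is its syndrome weight. Every syndrome that occurs comes from a pair of
classical errors; with both chosen as light as possible, the component lies in the fattening whose
radius is the sum of the two classical distances (`isPositive_of_soundness`). Normalising by the
number of all generators rather than those of one type costs only a factor depending on w: d ≥ 2
excludes zero columns, so n ≤ wm, and testing a single bit error gives ρm ≤ wn. -/

theorem hammingNorm_eq_sum (f : α → ZMod 2) :
    hammingNorm f = ∑ a, if f a ≠ 0 then 1 else 0 := by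
  simp [hammingNorm, Finset.card_filter]

theorem hammingNorm_sum_type (f : α ⊕ β → ZMod 2) :
    hammingNorm f = hammingNorm (fun a => f (.inl a)) + hammingNorm (fun b => f (.inr b)) := by
  simp only [hammingNorm_eq_sum, Fintype.sum_sum_type]

theorem hammingNorm_prod_type (f : α × β → ZMod 2) :
    hammingNorm f = ∑ b, hammingNorm (fun a => f (a, b)) := by
  simp only [hammingNorm_eq_sum, Fintype.sum_prod_type_right]

theorem hammingNorm_mul (f : α → ZMod 2) (g : β → ZMod 2) :
    hammingNorm (fun p : α × β => f p.1 * g p.2) = hammingNorm f * hammingNorm g := by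
  simp only [hammingNorm_eq_sum, Fintype.sum_prod_type, Finset.sum_mul_sum]
  refine Finset.sum_congr rfl fun a _ => Finset.sum_congr rfl fun b _ => ?_
  by_cases h : f a = 0 <;> by_cases h' : g b = 0 <;> simp [h, h']

theorem hammingNorm_single_one [DecidableEq α] (a : α) :
    hammingNorm (Pi.single a 1 : α → ZMod 2) = 1 := by
  simp [hammingNorm_eq_sum, Pi.single_apply]

theorem hammingNorm_add_le (x y : α → ZMod 2) :
    hammingNorm (x + y) ≤ hammingNorm x + hammingNorm y := by
  have h := hammingDist_triangle x 0 (-y)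
  rwa [hammingDist_eq_hammingNorm, hammingDist_zero_right, hammingDist_zero_left,
    ZModModule.neg_eq_self, ZModModule.neg_eq_self] at h

theorem hammingNorm_finset_sum_le {γ : Type*} (s : Finset γ) (x : γ → α → ZMod 2) :
    hammingNorm (∑ c ∈ s, x c) ≤ ∑ c ∈ s, hammingNorm (x c) := by
  classical
  induction s using Finset.induction_on with
  | empty => simp
  | insert a s ha ih =>
    rw [Finset.sum_insert ha, Finset.sum_insert ha]
    exact (hammingNorm_add_le _ _).trans (Nat.add_le_add_left ih _)

theorem hammingDist_eq_hammingNorm_add (x y : α → ZMod 2) :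
    hammingDist x y = hammingNorm (x + y) := by
  rw [hammingDist_eq_hammingNorm, ZModModule.neg_eq_self]

theorem distTo_le {x c : α → ZMod 2} {C : Submodule (ZMod 2) (α → ZMod 2)} (hc : c ∈ C) :
    distTo x C ≤ hammingNorm (x + c) :=
  Nat.sInf_le ⟨c, hc, hammingDist_eq_hammingNorm_add x c⟩

theorem exists_hammingNorm_eq_distTo (x : α → ZMod 2) (C : Submodule (ZMod 2) (α → ZMod 2)) :
    ∃ c ∈ C, hammingNorm (x + c) = distTo x C := by
  obtain ⟨c, hc, h⟩ :=
    Nat.sInf_mem (s := {t | ∃ c ∈ C, hammingDist x c = t}) ⟨_, 0, C.zero_mem, rfl⟩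
  exact ⟨c, hc, by rw [← hammingDist_eq_hammingNorm_add, h]; rfl⟩

theorem mem_kerCode {H : Matrix M α (ZMod 2)} {x : α → ZMod 2} :
    x ∈ kerCode H ↔ H.mulVec x = 0 := by
  simp [kerCode]

theorem mem_dualCode {C : Submodule (ZMod 2) (α → ZMod 2)} {x : α → ZMod 2} :
    x ∈ dualCode C ↔ ∀ c ∈ C, x ⬝ᵥ c = 0 := Iff.rfl

end Hamming

/-! ### Row and column weights -/

section Weights

variable {M M' α β : Type*}

theorem rowWeight_transpose [Fintype M] (A : Matrix M α (ZMod 2)) (a : α) :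
    rowWeight A.transpose a = colWeight A a := rfl

theorem colWeight_transpose [Fintype α] (A : Matrix M α (ZMod 2)) (i : M) :
    colWeight A.transpose i = rowWeight A i := rfl

theorem rowWeight_kronecker [Fintype α] [Fintype β] (A : Matrix M α (ZMod 2)) (B : Matrix M' β (ZMod 2)) (i : M × M') :
    rowWeight (A ⊗ₖ B) i = rowWeight A i.1 * rowWeight B i.2 :=
  hammingNorm_mul (A i.1) (B i.2)

theorem colWeight_kronecker [Fintype M] [Fintype M'] (A : Matrix M α (ZMod 2)) (B : Matrix M' β (ZMod 2)) (j : α × β) :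
    colWeight (A ⊗ₖ B) j = colWeight A j.1 * colWeight B j.2 :=
  hammingNorm_mul (fun i => A i j.1) (fun i => B i j.2)

theorem rowWeight_fromCols [Fintype α] [Fintype β] (A : Matrix M α (ZMod 2)) (B : Matrix M β (ZMod 2)) (i : M) :
    rowWeight (Matrix.fromCols A B) i = rowWeight A i + rowWeight B i :=
  hammingNorm_sum_type _

theorem colWeight_fromCols_inl [Fintype M] (A : Matrix M α (ZMod 2)) (B : Matrix M β (ZMod 2)) (j : α) :
    colWeight (Matrix.fromCols A B) (.inl j) = colWeight A j := rfl

theorem colWeight_fromCols_inr [Fintype M] (A : Matrix M α (ZMod 2)) (B : Matrix M β (ZMod 2)) (j : β) :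
    colWeight (Matrix.fromCols A B) (.inr j) = colWeight B j := rfl

theorem rowWeight_fromBlocks_inl [Fintype α] [Fintype β] (A : Matrix M α (ZMod 2)) (B : Matrix M β (ZMod 2))
    (C : Matrix M' α (ZMod 2)) (D : Matrix M' β (ZMod 2)) (i : M) :
    rowWeight (Matrix.fromBlocks A B C D) (.inl i) = rowWeight A i + rowWeight B i :=
  hammingNorm_sum_type _

theorem rowWeight_fromBlocks_inr [Fintype α] [Fintype β] (A : Matrix M α (ZMod 2)) (B : Matrix M β (ZMod 2))
    (C : Matrix M' α (ZMod 2)) (D : Matrix M' β (ZMod 2)) (i : M') :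
    rowWeight (Matrix.fromBlocks A B C D) (.inr i) = rowWeight C i + rowWeight D i :=
  hammingNorm_sum_type _

theorem colWeight_fromBlocks_inl [Fintype M] [Fintype M'] (A : Matrix M α (ZMod 2)) (B : Matrix M β (ZMod 2))
    (C : Matrix M' α (ZMod 2)) (D : Matrix M' β (ZMod 2)) (j : α) :
    colWeight (Matrix.fromBlocks A B C D) (.inl j) = colWeight A j + colWeight C j :=
  hammingNorm_sum_type _

theorem colWeight_fromBlocks_inr [Fintype M] [Fintype M'] (A : Matrix M α (ZMod 2)) (B : Matrix M β (ZMod 2))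
    (C : Matrix M' α (ZMod 2)) (D : Matrix M' β (ZMod 2)) (j : β) :
    colWeight (Matrix.fromBlocks A B C D) (.inr j) = colWeight B j + colWeight D j :=
  hammingNorm_sum_type _

theorem rowWeight_one [Fintype α] [DecidableEq α] (a : α) : rowWeight (1 : Matrix α α (ZMod 2)) a = 1 := by
  simp [rowWeight, hammingNorm_eq_sum, Matrix.one_apply]

theorem colWeight_one [Fintype α] [DecidableEq α] (a : α) : colWeight (1 : Matrix α α (ZMod 2)) a = 1 := by
  simp [colWeight, hammingNorm_eq_sum, Matrix.one_apply]

theorem rowWeight_zero [Fintype α] (i : M) : rowWeight (0 : Matrix M α (ZMod 2)) i = 0 :=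
  hammingNorm_zero

theorem colWeight_zero [Fintype M] (j : α) : colWeight (0 : Matrix M α (ZMod 2)) j = 0 :=
  hammingNorm_zero

end Weights

/-! ### The star-balanced code with `p + 1` vertices -/

/-- `starBalanced H (p + 1)`, with the edges of the star indexed by `Fin p`. -/
def starCode {n m : ℕ} (H : Matrix (Fin m) (Fin n) (ZMod 2)) (p : ℕ) :
    CSSCode (Fin m × Fin (p + 1)) (((Fin n ⊕ Fin n) × Fin p) ⊕ (Fin n × Fin (p + 1)))
      (((Fin n ⊕ Fin n) × Fin (p + 1)) ⊕ (Fin m × Fin p)) :=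
  starBalanced H (p + 1)

/-- `starMatrix (p + 1)`, with the edges of the star indexed by `Fin p`. -/
def starIncidence (p : ℕ) : Matrix (Fin (p + 1)) (Fin p) (ZMod 2) := starMatrix (p + 1)

theorem starIncidence_castSucc {p : ℕ} (v e : Fin p) :
    starIncidence p v.castSucc e = if v = e then 1 else 0 := by
  have : ¬ (v : ℕ) = p := v.isLt.ne
  simp [starIncidence, starMatrix, Fin.ext_iff, this]

theorem starIncidence_last {p : ℕ} (e : Fin p) : starIncidence p (Fin.last p) e = 1 := by
  simp [starIncidence, starMatrix]

theorem rowWeight_starIncidence_castSucc {p : ℕ} (v : Fin p) :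
    rowWeight (starIncidence p) v.castSucc = 1 := by
  simp [rowWeight, hammingNorm_eq_sum, starIncidence_castSucc]

theorem rowWeight_starIncidence_last (p : ℕ) :
    rowWeight (starIncidence p) (Fin.last p) = p := by
  simp [rowWeight, hammingNorm_eq_sum, starIncidence_last]

theorem colWeight_starIncidence {p : ℕ} (e : Fin p) : colWeight (starIncidence p) e = 2 := by
  simp [colWeight, hammingNorm_eq_sum, Fin.sum_univ_castSucc, starIncidence_castSucc,
    starIncidence_last]

section StarCode

variable {n m p : ℕ} (H : Matrix (Fin m) (Fin n) (ZMod 2))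

theorem starCode_hX : (starCode H p).hX =
    Matrix.fromCols ((gaugeFixed H).hX ⊗ₖ (1 : Matrix (Fin (p + 1)) (Fin (p + 1)) (ZMod 2)))
      ((1 : Matrix (Fin m) (Fin m) (ZMod 2)) ⊗ₖ starIncidence p) := rfl

theorem starCode_hZ : (starCode H p).hZ =
    Matrix.fromBlocks
      ((1 : Matrix (Fin n ⊕ Fin n) (Fin n ⊕ Fin n) (ZMod 2)) ⊗ₖ (starIncidence p).transpose)
      ((gaugeFixed H).hX.transpose ⊗ₖ (1 : Matrix (Fin p) (Fin p) (ZMod 2)))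
      ((gaugeFixed H).hZ ⊗ₖ (1 : Matrix (Fin (p + 1)) (Fin (p + 1)) (ZMod 2))) 0 := rfl

theorem rowWeight_gaugeFixed_hX (i : Fin m) :
    rowWeight (gaugeFixed H).hX i = 2 * rowWeight H i := by
  rw [gaugeFixed, rowWeight_fromCols, two_mul]

theorem colWeight_gaugeFixed_hX (a : Fin n ⊕ Fin n) :
    colWeight (gaugeFixed H).hX a = colWeight H (a.elim id id) := by
  cases a <;> rfl

theorem rowWeight_gaugeFixed_hZ (j : Fin n) : rowWeight (gaugeFixed H).hZ j = 2 := by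
  rw [gaugeFixed, rowWeight_fromCols, rowWeight_one]

theorem colWeight_gaugeFixed_hZ (a : Fin n ⊕ Fin n) : colWeight (gaugeFixed H).hZ a = 1 := by
  cases a <;> exact colWeight_one _

theorem rowWeight_starCode_hX (i : Fin m × Fin (p + 1)) :
    rowWeight (starCode H p).hX i = 2 * rowWeight H i.1 + rowWeight (starIncidence p) i.2 := by
  rw [starCode_hX, rowWeight_fromCols, rowWeight_kronecker, rowWeight_kronecker, rowWeight_one,
    rowWeight_one, rowWeight_gaugeFixed_hX, mul_one, one_mul]

theorem colWeight_starCode_hX_inl (q : (Fin n ⊕ Fin n) × Fin (p + 1)) :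
    colWeight (starCode H p).hX (.inl q) = colWeight H (q.1.elim id id) := by
  rw [starCode_hX, colWeight_fromCols_inl, colWeight_kronecker, colWeight_one,
    colWeight_gaugeFixed_hX, mul_one]

theorem colWeight_starCode_hX_inr (q : Fin m × Fin p) :
    colWeight (starCode H p).hX (.inr q) = 2 := by
  rw [starCode_hX, colWeight_fromCols_inr, colWeight_kronecker, colWeight_one,
    colWeight_starIncidence, one_mul]

theorem rowWeight_starCode_hZ_inl (i : (Fin n ⊕ Fin n) × Fin p) :
    rowWeight (starCode H p).hZ (.inl i) = 2 + colWeight H (i.1.elim id id) := by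
  rw [starCode_hZ, rowWeight_fromBlocks_inl, rowWeight_kronecker, rowWeight_kronecker,
    rowWeight_transpose, rowWeight_transpose, rowWeight_one, rowWeight_one,
    colWeight_starIncidence, colWeight_gaugeFixed_hX, mul_one, one_mul]

theorem rowWeight_starCode_hZ_inr (i : Fin n × Fin (p + 1)) :
    rowWeight (starCode H p).hZ (.inr i) = 2 := by
  rw [starCode_hZ, rowWeight_fromBlocks_inr, rowWeight_kronecker, rowWeight_one,
    rowWeight_gaugeFixed_hZ, rowWeight_zero]

theorem colWeight_starCode_hZ_inl (q : (Fin n ⊕ Fin n) × Fin (p + 1)) :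
    colWeight (starCode H p).hZ (.inl q) = rowWeight (starIncidence p) q.2 + 1 := by
  rw [starCode_hZ, colWeight_fromBlocks_inl, colWeight_kronecker, colWeight_kronecker,
    colWeight_transpose, colWeight_one, colWeight_one, colWeight_gaugeFixed_hZ, one_mul]

theorem colWeight_starCode_hZ_inr (q : Fin m × Fin p) :
    colWeight (starCode H p).hZ (.inr q) = 2 * rowWeight H q.1 := by
  rw [starCode_hZ, colWeight_fromBlocks_inr, colWeight_kronecker, colWeight_transpose,
    colWeight_one, rowWeight_gaugeFixed_hX, colWeight_zero, mul_one, add_zero]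

theorem starCode_hX_mulVec_castSucc (q : ((Fin n ⊕ Fin n) × Fin (p + 1)) ⊕ (Fin m × Fin p) → ZMod 2)
    (i : Fin m) (e : Fin p) : (starCode H p).hX.mulVec q (i, e.castSucc) =
      H.mulVec (fun j => q (.inl (.inl j, e.castSucc)) + q (.inl (.inr j, e.castSucc))) i
        + q (.inr (i, e)) := by
  rw [starCode_hX]
  simp [gaugeFixed, Matrix.mulVec, dotProduct, Fintype.sum_sum_type, Fintype.sum_prod_type,
    Matrix.one_apply, starIncidence_castSucc, mul_add, Finset.sum_add_distrib]

theorem starCode_hX_mulVec_last (q : ((Fin n ⊕ Fin n) × Fin (p + 1)) ⊕ (Fin m × Fin p) → ZMod 2)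
    (i : Fin m) : (starCode H p).hX.mulVec q (i, Fin.last p) =
      H.mulVec (fun j => q (.inl (.inl j, Fin.last p)) + q (.inl (.inr j, Fin.last p))) i
        + ∑ e, q (.inr (i, e)) := by
  rw [starCode_hX]
  simp [gaugeFixed, Matrix.mulVec, dotProduct, Fintype.sum_sum_type, Fintype.sum_prod_type,
    Matrix.one_apply, starIncidence_last, mul_add, Finset.sum_add_distrib]
  rw [Finset.sum_comm]
  simp

theorem starCode_hZ_mulVec_inl (q : ((Fin n ⊕ Fin n) × Fin (p + 1)) ⊕ (Fin m × Fin p) → ZMod 2)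
    (a : Fin n ⊕ Fin n) (e : Fin p) : (starCode H p).hZ.mulVec q (.inl (a, e)) =
      q (.inl (a, e.castSucc)) + q (.inl (a, Fin.last p))
        + H.transpose.mulVec (fun i => q (.inr (i, e))) (a.elim id id) := by
  rw [starCode_hZ]
  cases a <;>
  simp [gaugeFixed, Matrix.mulVec, dotProduct, Fintype.sum_sum_type, Fintype.sum_prod_type,
    Matrix.one_apply, starIncidence_last, starIncidence_castSucc, Fin.sum_univ_castSucc]

theorem starCode_hZ_mulVec_inr (q : ((Fin n ⊕ Fin n) × Fin (p + 1)) ⊕ (Fin m × Fin p) → ZMod 2)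
    (j : Fin n) (v : Fin (p + 1)) : (starCode H p).hZ.mulVec q (.inr (j, v)) =
      q (.inl (.inl j, v)) + q (.inl (.inr j, v)) := by
  rw [starCode_hZ]
  simp [gaugeFixed, Matrix.mulVec, dotProduct, Fintype.sum_sum_type, Fintype.sum_prod_type,
    Matrix.one_apply]

end StarCode

theorem distTo_le_of_add_mem {α : Type*} [Fintype α] {x y : α → ZMod 2}
    {C : Submodule (ZMod 2) (α → ZMod 2)} (h : x + y ∈ C) : distTo x C ≤ hammingNorm y := by
  have := distTo_le (x := x) h
  rwa [← add_assoc, ZModModule.add_self, zero_add] at this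

theorem add_eq_zero_iff_eq_zmodTwo {G : Type*} [AddCommGroup G] [Module (ZMod 2) G] {x y : G} :
    x + y = 0 ↔ x = y := by
  rw [add_eq_zero_iff_eq_neg, ZModModule.neg_eq_self]

/-! ### Words on the star, read as vertex and edge blocks -/

section StarCode

variable {n m p : ℕ}

/-- Words on the qubits of `starCode`. -/
abbrev StarWord (n m p : ℕ) : Type :=
  ((Fin n ⊕ Fin n) × Fin (p + 1)) ⊕ (Fin m × Fin p) → ZMod 2

namespace StarWord

/-- The first half of the block at vertex `v`. -/
def left (q : StarWord n m p) (v : Fin (p + 1)) : Fin n → ZMod 2 := fun j => q (.inl (.inl j, v))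

/-- The second half of the block at vertex `v`. -/
def right (q : StarWord n m p) (v : Fin (p + 1)) : Fin n → ZMod 2 := fun j => q (.inl (.inr j, v))

/-- The block at edge `e`. -/
def edge (q : StarWord n m p) (e : Fin p) : Fin m → ZMod 2 := fun i => q (.inr (i, e))

/-- The sum of the two halves of all vertex blocks. -/
def total (q : StarWord n m p) : Fin n → ZMod 2 := ∑ v, (left q v + right q v)

theorem hammingNorm_eq (q : StarWord n m p) :
    hammingNorm q = (∑ v, (hammingNorm (left q v) + hammingNorm (right q v)))
      + ∑ e, hammingNorm (edge q e) := by
  rw [hammingNorm_sum_type, hammingNorm_prod_type, hammingNorm_prod_type]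
  simp only [hammingNorm_sum_type]
  rfl

theorem dotProduct_eq (q r : StarWord n m p) :
    q ⬝ᵥ r = (∑ v, (left q v ⬝ᵥ left r v + right q v ⬝ᵥ right r v))
      + ∑ e, edge q e ⬝ᵥ edge r e := by
  simp only [dotProduct, Fintype.sum_sum_type, Fintype.sum_prod_type_right]
  rfl

/-- The word with given blocks. -/
def ofBlocks (x x' : Fin (p + 1) → Fin n → ZMod 2) (y : Fin p → Fin m → ZMod 2) :
    StarWord n m p :=
  Sum.elim (fun a => a.1.elim (x a.2) (x' a.2)) (fun a => y a.2 a.1)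

theorem left_ofBlocks (x x' : Fin (p + 1) → Fin n → ZMod 2) (y : Fin p → Fin m → ZMod 2)
    (v : Fin (p + 1)) : left (ofBlocks x x' y) v = x v := rfl

theorem right_ofBlocks (x x' : Fin (p + 1) → Fin n → ZMod 2) (y : Fin p → Fin m → ZMod 2)
    (v : Fin (p + 1)) : right (ofBlocks x x' y) v = x' v := rfl

theorem edge_ofBlocks (x x' : Fin (p + 1) → Fin n → ZMod 2) (y : Fin p → Fin m → ZMod 2)
    (e : Fin p) : edge (ofBlocks x x' y) e = y e := rfl

theorem left_add (q r : StarWord n m p) (v : Fin (p + 1)) :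
    left (q + r) v = left q v + left r v := rfl

theorem right_add (q r : StarWord n m p) (v : Fin (p + 1)) :
    right (q + r) v = right q v + right r v := rfl

theorem edge_add (q r : StarWord n m p) (e : Fin p) : edge (q + r) e = edge q e + edge r e := rfl

theorem ext {q r : StarWord n m p} (hl : ∀ v, left q v = left r v)
    (hr : ∀ v, right q v = right r v) (he : ∀ e, edge q e = edge r e) : q = r := by
  funext a
  rcases a with ⟨j | j, v⟩ | ⟨i, e⟩
  · exact congrFun (hl v) j
  · exact congrFun (hr v) j
  · exact congrFun (he e) i

end StarWord

open StarWord

variable (H : Matrix (Fin m) (Fin n) (ZMod 2))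

theorem hX_leaf (q : StarWord n m p) (e : Fin p) :
    (fun i => (starCode H p).hX.mulVec q (i, e.castSucc)) =
      H.mulVec (left q e.castSucc + right q e.castSucc) + edge q e :=
  funext fun i => starCode_hX_mulVec_castSucc H q i e

theorem hX_centre (q : StarWord n m p) :
    (fun i => (starCode H p).hX.mulVec q (i, Fin.last p)) =
      H.mulVec (left q (Fin.last p) + right q (Fin.last p)) + ∑ e, edge q e := by
  funext i
  rw [Pi.add_apply, Finset.sum_apply]
  exact starCode_hX_mulVec_last H q i

theorem hZ_left (q : StarWord n m p) (e : Fin p) :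
    (fun j => (starCode H p).hZ.mulVec q (.inl (.inl j, e))) =
      left q e.castSucc + left q (Fin.last p) + H.transpose.mulVec (edge q e) :=
  funext fun j => starCode_hZ_mulVec_inl H q (.inl j) e

theorem hZ_right (q : StarWord n m p) (e : Fin p) :
    (fun j => (starCode H p).hZ.mulVec q (.inl (.inr j, e))) =
      right q e.castSucc + right q (Fin.last p) + H.transpose.mulVec (edge q e) :=
  funext fun j => starCode_hZ_mulVec_inl H q (.inr j) e

theorem hZ_vertex (q : StarWord n m p) (v : Fin (p + 1)) :
    (fun j => (starCode H p).hZ.mulVec q (.inr (j, v))) = left q v + right q v :=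
  funext fun j => starCode_hZ_mulVec_inr H q j v

theorem mem_kerCode_hX {q : StarWord n m p} : q ∈ kerCode (starCode H p).hX ↔
    (∀ e, H.mulVec (left q e.castSucc + right q e.castSucc) + edge q e = 0) ∧
      H.mulVec (left q (Fin.last p) + right q (Fin.last p)) + ∑ e, edge q e = 0 := by
  rw [mem_kerCode, ← hX_centre]
  simp only [← hX_leaf]
  constructor
  · intro h
    exact ⟨fun e => funext fun i => congrFun h _, funext fun i => congrFun h _⟩
  · rintro ⟨h, h'⟩
    funext ⟨i, v⟩
    induction v using Fin.lastCases with
    | last => exact congrFun h' i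
    | cast e => exact congrFun (h e) i

/-- The edge checks on the right halves are redundant: they follow from those on the left halves
once the two halves agree at every vertex. -/
theorem mem_kerCode_hZ {q : StarWord n m p} : q ∈ kerCode (starCode H p).hZ ↔
    (∀ e, left q e.castSucc + left q (Fin.last p) + H.transpose.mulVec (edge q e) = 0) ∧
      ∀ v, left q v + right q v = 0 := by
  rw [mem_kerCode]
  constructor
  · intro h
    refine ⟨fun e => ?_, fun v => ?_⟩
    · rw [← hZ_left, h]; rfl
    · rw [← hZ_vertex H, h]; rfl
  · rintro ⟨h, h'⟩
    have hlr : ∀ v, right q v = left q v := fun v => by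
      rw [eq_comm, ← add_eq_zero_iff_eq_zmodTwo, h']
    funext a
    rcases a with ⟨j | j, e⟩ | ⟨j, v⟩
    · exact congrFun ((hZ_left H q e).trans (h e)) j
    · have hr := hZ_right H q e
      rw [hlr, hlr, h] at hr
      exact congrFun hr j
    · exact congrFun ((hZ_vertex H q v).trans (h' v)) j

/-- Each edge block occurs once at its leaf and once at the centre, so it cancels in the sum over
vertices. -/
theorem mulVec_total (q : StarWord n m p) :
    H.mulVec (total q) = ∑ v, fun i => (starCode H p).hX.mulVec q (i, v) := by
  rw [Fin.sum_univ_castSucc, hX_centre]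
  simp only [hX_leaf, Finset.sum_add_distrib]
  rw [total, ← Matrix.mulVecLin_apply, map_sum, Fin.sum_univ_castSucc]
  simp only [Matrix.mulVecLin_apply]
  rw [add_assoc, add_comm _ (∑ e, edge q e), ← add_assoc (∑ e, edge q e), ZModModule.add_self,
    zero_add]

theorem total_mem_kerCode {q : StarWord n m p} (hq : q ∈ kerCode (starCode H p).hX) :
    total q ∈ kerCode H := by
  rw [mem_kerCode] at hq ⊢
  rw [mulVec_total, hq]
  exact Finset.sum_eq_zero fun _ _ => rfl

theorem hammingNorm_total_le (q : StarWord n m p) : hammingNorm (total q) ≤ hammingNorm q := by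
  rw [hammingNorm_eq]
  refine (hammingNorm_finset_sum_le _ _).trans (le_trans ?_ (Nat.le_add_right _ _))
  exact Finset.sum_le_sum fun v _ => hammingNorm_add_le _ _

theorem hammingNorm_mulVec_total_le (q : StarWord n m p) :
    hammingNorm (H.mulVec (total q)) ≤ hammingNorm ((starCode H p).hX.mulVec q) := by
  rw [mulVec_total, hammingNorm_prod_type]
  exact hammingNorm_finset_sum_le _ _

theorem dotProduct_transpose_mulVec (x : Fin n → ZMod 2) (y : Fin m → ZMod 2) :
    x ⬝ᵥ H.transpose.mulVec y = H.mulVec x ⬝ᵥ y := by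
  rw [Matrix.dotProduct_mulVec, Matrix.vecMul_transpose]

theorem left_castSucc_of_mem {c : StarWord n m p} (hc : c ∈ kerCode (starCode H p).hZ)
    (e : Fin p) :
    left c e.castSucc = left c (Fin.last p) + H.transpose.mulVec (edge c e) := by
  rw [← add_eq_zero_iff_eq_zmodTwo, ← add_assoc]
  exact ((mem_kerCode_hZ H).mp hc).1 e

theorem right_of_mem {c : StarWord n m p} (hc : c ∈ kerCode (starCode H p).hZ)
    (v : Fin (p + 1)) : right c v = left c v := by
  rw [eq_comm, ← add_eq_zero_iff_eq_zmodTwo]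
  exact ((mem_kerCode_hZ H).mp hc).2 v

/-- Replacing the leaf blocks of `c` by the centre block costs a term pairing the H-syndrome of the
leaf of `u` with the edge block of `c`. The X-checks make this equal to the edge contribution, so
the two cancel. -/
theorem dotProduct_eq_total_dotProduct {u c : StarWord n m p}
    (hu : u ∈ kerCode (starCode H p).hX) (hc : c ∈ kerCode (starCode H p).hZ) :
    u ⬝ᵥ c = total u ⬝ᵥ left c (Fin.last p) := by
  have hu' : ∀ e, edge u e = H.mulVec (left u e.castSucc + right u e.castSucc) := fun e => by
    rw [eq_comm, ← add_eq_zero_iff_eq_zmodTwo]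
    exact ((mem_kerCode_hX H).mp hu).1 e
  rw [StarWord.dotProduct_eq, total, sum_dotProduct]
  simp only [right_of_mem H hc, ← add_dotProduct]
  rw [Fin.sum_univ_castSucc, Fin.sum_univ_castSucc]
  simp only [left_castSucc_of_mem H hc, dotProduct_add, dotProduct_transpose_mulVec, hu',
    Finset.sum_add_distrib]
  rw [add_right_comm, add_assoc (∑ e : Fin p, _), ZModModule.add_self, add_zero]

/-! ### Soundness of the component codes -/

theorem exists_distTo_hX_le (q : StarWord n m p) :
    distTo q (kerCode (starCode H p).hX) ≤
      hammingNorm ((starCode H p).hX.mulVec q) + distTo (total q) (kerCode H) := by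
  set s := (starCode H p).hX.mulVec q with hs
  obtain ⟨c, hc, hzc⟩ := exists_hammingNorm_eq_distTo (total q) (kerCode H)
  set y : Fin p → Fin m → ZMod 2 := fun e i => s (i, e.castSucc) with hy
  have hye : ∀ e, H.mulVec (left q e.castSucc + right q e.castSucc) + edge q e = y e :=
    fun e => (hX_leaf H q e).symm
  -- The edge blocks absorb the leaf syndromes; adding `total q + c` to one half of the centre makes
  -- the total of the corrected word equal to the codeword `c` nearest to `total q`, which settles
  -- the centre check.
  let δ : StarWord n m p := ofBlocks (Pi.single (Fin.last p) (total q + c)) 0 y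
  have hmem : q + δ ∈ kerCode (starCode H p).hX := by
    rw [mem_kerCode_hX]
    refine ⟨fun e => ?_, ?_⟩
    · rw [left_add, right_add, edge_add, left_ofBlocks, right_ofBlocks, edge_ofBlocks,
        Pi.single_eq_of_ne (Fin.castSucc_lt_last e).ne, Pi.zero_apply, add_zero, add_zero,
        ← add_assoc, hye, ZModModule.add_self]
    · have htot : H.mulVec (total q) = ∑ e, y e + fun i => s (i, Fin.last p) := by
        rw [mulVec_total, Fin.sum_univ_castSucc]
      rw [hX_centre] at htot
      rw [left_add, right_add, left_ofBlocks, right_ofBlocks, Pi.single_eq_same, Pi.zero_apply,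
        add_zero, add_right_comm, Matrix.mulVec_add, Matrix.mulVec_add _ (total q),
        mem_kerCode.mp hc, add_zero, htot]
      simp only [edge_add, Finset.sum_add_distrib]
      simp only [δ, edge_ofBlocks]
      rw [← add_eq_zero_iff_eq_zmodTwo] at htot
      generalize H.mulVec (left q (Fin.last p) + right q (Fin.last p)) = A
      generalize ∑ e, edge q e = B
      generalize ∑ e, y e = C
      rw [show A + (C + (A + B)) + (B + C) = (A + A) + (B + B) + (C + C) by abel]
      simp only [ZModModule.add_self]
  refine (distTo_le_of_add_mem hmem).trans ?_
  rw [hammingNorm_eq, Fin.sum_univ_castSucc, hammingNorm_prod_type s, Fin.sum_univ_castSucc, ← hzc]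
  simp only [δ, left_ofBlocks, right_ofBlocks, edge_ofBlocks, Pi.single_eq_same, Pi.zero_apply,
    Pi.single_eq_of_ne (Fin.castSucc_lt_last _).ne, hammingNorm_zero, add_zero,
    Finset.sum_const_zero, zero_add, hy]
  omega

theorem distTo_hZ_le (q : StarWord n m p) :
    distTo q (kerCode (starCode H p).hZ) ≤ 2 * hammingNorm ((starCode H p).hZ.mulVec q) := by
  set s := (starCode H p).hZ.mulVec q with hs
  -- Each left leaf block is corrected by its own edge syndrome, the centre and the edges staying
  -- fixed; each right block is then made equal to its left block. The correction `x` is thus paid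
  -- at most twice and the vertex syndrome once, whence the factor 2.
  let x : Fin (p + 1) → Fin n → ZMod 2 :=
    Fin.lastCases 0 fun e j => s (.inl (.inl j, e))
  have hxl : x (Fin.last p) = 0 := Fin.lastCases_last
  have hxe : ∀ e : Fin p, x e.castSucc =
      left q e.castSucc + left q (Fin.last p) + H.transpose.mulVec (edge q e) := fun e =>
    (Fin.lastCases_castSucc e).trans (hZ_left H q e)
  have hxe' : ∀ e : Fin p, x e.castSucc = fun j => s (.inl (.inl j, e)) := fun e =>
    Fin.lastCases_castSucc e
  let δ : StarWord n m p := ofBlocks x (fun v => x v + fun j => s (.inr (j, v))) 0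
  have hmem : q + δ ∈ kerCode (starCode H p).hZ := by
    rw [mem_kerCode_hZ]
    refine ⟨fun e => ?_, fun v => ?_⟩
    · rw [left_add, left_add, edge_add, left_ofBlocks, left_ofBlocks, edge_ofBlocks, hxl, hxe,
        Pi.zero_apply, add_zero, add_zero]
      rw [show ∀ A B C : Fin n → ZMod 2, A + (A + B + C) + B + C =
        (A + A) + (B + B) + (C + C) from fun A B C => by abel]
      simp only [ZModModule.add_self]
    · rw [left_add, right_add, left_ofBlocks, right_ofBlocks, hs, hZ_vertex]
      rw [show ∀ A B C : Fin n → ZMod 2, A + C + (B + (C + (A + B))) =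
        (A + A) + (B + B) + (C + C) from fun A B C => by abel]
      simp only [ZModModule.add_self]
  refine (distTo_le_of_add_mem hmem).trans ?_
  have hx : ∑ v, hammingNorm (x v) ≤ hammingNorm fun a => s (.inl a) := by
    rw [Fin.sum_univ_castSucc, hxl, hammingNorm_zero, add_zero, hammingNorm_prod_type]
    refine Finset.sum_le_sum fun e _ => ?_
    rw [hammingNorm_sum_type, hxe']
    exact Nat.le_add_right _ _
  have hy : ∑ v, hammingNorm (x v + fun j => s (.inr (j, v))) ≤
      ∑ v, hammingNorm (x v) + hammingNorm fun a => s (.inr a) := by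
    rw [hammingNorm_prod_type, ← Finset.sum_add_distrib]
    exact Finset.sum_le_sum fun v _ => hammingNorm_add_le _ _
  rw [hammingNorm_eq, hammingNorm_sum_type s, Finset.sum_add_distrib]
  simp only [δ, left_ofBlocks, right_ofBlocks, edge_ofBlocks, Pi.zero_apply, hammingNorm_zero,
    Finset.sum_const_zero, add_zero]
  omega

/-! ### Logical operators -/

theorem vecMul_hX_left (u : Fin m × Fin (p + 1) → ZMod 2) (v : Fin (p + 1)) :
    left (Matrix.vecMul u (starCode H p).hX) v = H.transpose.mulVec fun i => u (i, v) := by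
  funext j
  rw [starCode_hX]
  simp [left, gaugeFixed, Matrix.vecMul, Matrix.mulVec, dotProduct, Fintype.sum_prod_type,
    Matrix.one_apply, mul_comm]

theorem vecMul_hX_right (u : Fin m × Fin (p + 1) → ZMod 2) (v : Fin (p + 1)) :
    right (Matrix.vecMul u (starCode H p).hX) v = H.transpose.mulVec fun i => u (i, v) := by
  funext j
  rw [starCode_hX]
  simp [right, gaugeFixed, Matrix.vecMul, Matrix.mulVec, dotProduct, Fintype.sum_prod_type,
    Matrix.one_apply, mul_comm]

theorem vecMul_hX_edge (u : Fin m × Fin (p + 1) → ZMod 2) (e : Fin p) :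
    edge (Matrix.vecMul u (starCode H p).hX) e =
      (fun i => u (i, e.castSucc)) + fun i => u (i, Fin.last p) := by
  funext i
  rw [starCode_hX]
  simp [edge, gaugeFixed, Matrix.vecMul, dotProduct, Fintype.sum_prod_type,
    Matrix.one_apply, Fin.sum_univ_castSucc, starIncidence_castSucc, starIncidence_last]

/-- The class of the centre block modulo the row space of `H`. -/
def centreClass (p : ℕ) : StarWord n m p →ₗ[ZMod 2]
    ((Fin n → ZMod 2) ⧸ LinearMap.range H.transpose.mulVecLin) :=
  (LinearMap.range H.transpose.mulVecLin).mkQ ∘ₗ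
    LinearMap.funLeft (ZMod 2) (ZMod 2) fun j => .inl (.inl j, Fin.last p)

theorem centreClass_apply (q : StarWord n m p) :
    centreClass H p q = Submodule.Quotient.mk (left q (Fin.last p)) := rfl

/-- The word repeating one vector in every half, with empty edges, passes all Z-checks. -/
theorem centreClass_surjective
    (w : (Fin n → ZMod 2) ⧸ LinearMap.range H.transpose.mulVecLin) :
    ∃ x ∈ kerCode (starCode H p).hZ, centreClass H p x = w := by
  obtain ⟨x, rfl⟩ := Submodule.Quotient.mk_surjective _ w
  refine ⟨ofBlocks (fun _ => x) (fun _ => x) 0, ?_, rfl⟩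
  rw [mem_kerCode_hZ]
  refine ⟨fun e => ?_, fun v => ZModModule.add_self x⟩
  rw [edge_ofBlocks, Pi.zero_apply, Matrix.mulVec_zero, add_zero]
  exact ZModModule.add_self x

theorem centreClass_row (i : Fin m × Fin (p + 1)) :
    centreClass H p ((starCode H p).hX i) = 0 := by
  rw [centreClass_apply, Submodule.Quotient.mk_eq_zero]
  refine ⟨fun i' => (Pi.single i 1 : Fin m × Fin (p + 1) → ZMod 2) (i', Fin.last p), ?_⟩
  rw [Matrix.mulVecLin_apply, ← vecMul_hX_left, Matrix.single_one_vecMul]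
  rfl

theorem exists_vecMul_of_centreClass_eq_zero {x : StarWord n m p}
    (hx : x ∈ kerCode (starCode H p).hZ) (h : centreClass H p x = 0) :
    ∃ u, Matrix.vecMul u (starCode H p).hX = x := by
  rw [centreClass_apply, Submodule.Quotient.mk_eq_zero] at h
  obtain ⟨y, hy⟩ := h
  rw [Matrix.mulVecLin_apply] at hy
  -- The centre block forces the coefficients `y` there; the leaf coefficients are then the ones
  -- whose sum with `y` is the edge block of `x`.
  let u : Fin (p + 1) → Fin m → ZMod 2 := Fin.lastCases y fun e => edge x e + y
  have hul : u (Fin.last p) = y := Fin.lastCases_last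
  have hue : ∀ e : Fin p, u e.castSucc = edge x e + y := fun e => Fin.lastCases_castSucc e
  have hleft : ∀ v, H.transpose.mulVec (u v) = left x v := by
    intro v
    induction v using Fin.lastCases with
    | last => rw [hul, hy]
    | cast e => rw [hue, Matrix.mulVec_add, hy, left_castSucc_of_mem H hx, add_comm]
  refine ⟨fun a => u a.2 a.1, StarWord.ext (fun v => ?_) (fun v => ?_) fun e => ?_⟩
  · rw [vecMul_hX_left, hleft]
  · rw [vecMul_hX_right, hleft, right_of_mem H hx]
  · rw [vecMul_hX_edge]
    change u e.castSucc + u (Fin.last p) = _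
    rw [hue, hul, add_assoc, ZModModule.add_self, add_zero]

/-- Row rank equals column rank, so the codimension of the row space is the nullity of H. -/
theorem card_quotient_range_transpose [Fintype
    ((Fin n → ZMod 2) ⧸ LinearMap.range H.transpose.mulVecLin)] :
    Fintype.card ((Fin n → ZMod 2) ⧸ LinearMap.range H.transpose.mulVecLin) =
      2 ^ Module.finrank (ZMod 2) (kerCode H) := by
  rw [Module.card_eq_pow_finrank (K := ZMod 2), ZMod.card]
  congr 1
  have h1 := Submodule.finrank_quotient_add_finrank (LinearMap.range H.transpose.mulVecLin)
  have h2 := LinearMap.finrank_range_add_finrank_ker H.mulVecLin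
  have h3 := H.rank_transpose
  rw [Matrix.rank, Matrix.rank] at h3
  rw [kerCode]
  omega

theorem isLeast_logicalWeights {d : ℕ}
    (hd : IsLeast {t | ∃ c ∈ kerCode H, c ≠ 0 ∧ hammingNorm c = t} d) :
    IsLeast (starCode H p).logicalWeights (min d (2 * (p + 1))) := by
  obtain ⟨⟨z, hz, hz0, hzd⟩, hmin⟩ := hd
  obtain ⟨j, hj⟩ := Function.ne_iff.mp hz0
  rw [Pi.zero_apply] at hj
  -- The two witnesses: a minimum-weight codeword in one half of the centre, and a bit of its
  -- support repeated in all 2(p + 1) halves. They pair to 1, so neither is trivial.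
  let u : StarWord n m p := ofBlocks (Pi.single (Fin.last p) z) 0 0
  let c : StarWord n m p := ofBlocks (fun _ => Pi.single j 1) (fun _ => Pi.single j 1) 0
  have hu : u ∈ kerCode (starCode H p).hX := by
    rw [mem_kerCode_hX]
    refine ⟨fun e => ?_, ?_⟩
    · simp only [u, left_ofBlocks, right_ofBlocks, edge_ofBlocks,
        Pi.single_eq_of_ne (Fin.castSucc_lt_last e).ne, Pi.zero_apply, add_zero, Matrix.mulVec_zero]
    · simp only [u, left_ofBlocks, right_ofBlocks, edge_ofBlocks, Pi.single_eq_same, Pi.zero_apply,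
        add_zero, Finset.sum_const_zero, mem_kerCode.mp hz]
  have hc : c ∈ kerCode (starCode H p).hZ := by
    rw [mem_kerCode_hZ]
    refine ⟨fun e => ?_, fun v => ZModModule.add_self _⟩
    simp only [c, left_ofBlocks, edge_ofBlocks, Pi.zero_apply, Matrix.mulVec_zero,
      ZModModule.add_self]
  have htot : total u = z := by
    simp only [total, u, left_ofBlocks, right_ofBlocks, Pi.zero_apply, add_zero]
    exact Finset.sum_pi_single' _ _ _ |>.trans (by simp)
  have huc : u ⬝ᵥ c ≠ 0 := by
    rw [dotProduct_eq_total_dotProduct H hu hc, htot, left_ofBlocks, dotProduct_single_one]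
    exact hj
  have hud : hammingNorm u = d := by
    rw [hammingNorm_eq, Fin.sum_univ_castSucc]
    simp only [u, left_ofBlocks, right_ofBlocks, edge_ofBlocks, Pi.single_eq_same, Pi.zero_apply,
      Pi.single_eq_of_ne (Fin.castSucc_lt_last _).ne, hammingNorm_zero, add_zero,
      Finset.sum_const_zero, zero_add, hzd]
  have hcd : hammingNorm c = 2 * (p + 1) := by
    rw [hammingNorm_eq]
    simp only [c, left_ofBlocks, right_ofBlocks, edge_ofBlocks, hammingNorm_single_one,
      Pi.zero_apply, hammingNorm_zero, Finset.sum_const_zero, add_zero, Finset.sum_const,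
      Finset.card_univ, Fintype.card_fin, smul_eq_mul]
    ring
  constructor
  · rcases min_choice d (2 * (p + 1)) with h | h <;> rw [h]
    · exact Or.inl ⟨u, hu, fun h => huc (h c hc), hud⟩
    · exact Or.inr ⟨c, hc, fun h => huc ((dotProduct_comm _ _).trans (h u hu)), hcd⟩
  · rintro t (⟨b, hb, hb', rfl⟩ | ⟨b, hb, hb', rfl⟩)
    · refine (min_le_left _ _).trans ((hmin ⟨total b, total_mem_kerCode H hb, ?_, rfl⟩).trans
        (hammingNorm_total_le b))
      intro h0
      refine hb' fun r hr => ?_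
      rw [dotProduct_eq_total_dotProduct H hb hr, h0, zero_dotProduct]
    · refine (min_le_right _ _).trans ?_
      rw [mem_dualCode] at hb'
      push Not at hb'
      obtain ⟨r, hr, hbr⟩ := hb'
      rw [dotProduct_comm, dotProduct_eq_total_dotProduct H hr hb] at hbr
      -- `total r` lies in `ker H`, hence is orthogonal to the row-space elements by which the
      -- blocks of `b` differ. One nonzero pairing therefore makes every block nonzero.
      have hv : ∀ v, total r ⬝ᵥ left b v = total r ⬝ᵥ left b (Fin.last p) := by
        intro v
        induction v using Fin.lastCases with
        | last => rfl
        | cast e =>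
          rw [left_castSucc_of_mem H hb, dotProduct_add, dotProduct_transpose_mulVec,
            mem_kerCode.mp (total_mem_kerCode H hr), zero_dotProduct, add_zero]
      have hone : ∀ v, 1 ≤ hammingNorm (left b v) := by
        intro v
        refine Nat.one_le_iff_ne_zero.mpr fun h0 => hbr ?_
        rw [← hv v, hammingNorm_eq_zero.mp h0, dotProduct_zero]
      rw [hammingNorm_eq]
      refine le_trans ?_ (Nat.le_add_right _ _)
      calc 2 * (p + 1) = ∑ _v : Fin (p + 1), 2 := by simp [mul_comm]
        _ ≤ _ := Finset.sum_le_sum fun v _ => by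
          rw [right_of_mem H hb]
          have := hone v
          omega

end StarCode

/-! ### Pauli operators -/

section Pauli

variable {ι : Type*} [Fintype ι]

/-- The sign `(-1) ^ a`. -/
def sgn (a : ZMod 2) : ℂ := if a = 0 then 1 else -1

theorem sgn_zero : sgn 0 = 1 := if_pos rfl

theorem sgn_add (a b : ZMod 2) : sgn (a + b) = sgn a * sgn b := by
  have h : ∀ a : ZMod 2, a = 0 ∨ a = 1 := by decide
  have h2 : (1 + 1 : ZMod 2) = 0 := by decide
  rcases h a with rfl | rfl <;> rcases h b with rfl | rfl <;> simp [sgn, h2]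

theorem sgn_sum {γ : Type*} (s : Finset γ) (f : γ → ZMod 2) :
    sgn (∑ i ∈ s, f i) = ∏ i ∈ s, sgn (f i) := by
  classical
  induction s using Finset.induction_on with
  | empty => simp [sgn_zero]
  | insert a s ha ih => rw [Finset.sum_insert ha, Finset.prod_insert ha, sgn_add, ih]

theorem sgn_mul_self (a : ZMod 2) : sgn a * sgn a = 1 := by
  rw [sgn]; split_ifs <;> norm_num

theorem sgn_injective : Function.Injective sgn := by
  have h : ∀ a : ZMod 2, a = 0 ∨ a = 1 := by decide
  intro a b hab
  rcases h a with rfl | rfl <;> rcases h b with rfl | rfl <;>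
    first | rfl | (exfalso; norm_num [sgn] at hab)

theorem conj_sgn (a : ZMod 2) : (starRingEnd ℂ) (sgn a) = sgn a := by
  rw [sgn]; split_ifs <;> simp

theorem exists_sgn_eq {z : ℂ} (h : z * z = 1) : ∃ a, sgn a = z := by
  rcases mul_self_eq_one_iff.mp h with rfl | rfl
  · exact ⟨0, by simp [sgn]⟩
  · exact ⟨1, by simp [sgn]⟩

/-- The amplitude of a state at a computational basis vector. -/
def amp (ψ : Qubits ι) (b : ι → ZMod 2) : ℂ := ψ.ofLp b

theorem amp_injective : Function.Injective (amp (ι := ι)) := by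
  intro ψ φ h
  ext b
  exact congrFun h b

theorem amp_ext {ψ φ : Qubits ι} (h : ∀ b, amp ψ b = amp φ b) : ψ = φ :=
  amp_injective (funext h)

theorem amp_smul (r : ℂ) (ψ : Qubits ι) (b : ι → ZMod 2) : amp (r • ψ) b = r * amp ψ b := rfl

/-- The state with given amplitudes. -/
def ofAmp (f : (ι → ZMod 2) → ℂ) : Qubits ι := WithLp.toLp 2 fun b => f b

theorem amp_ofAmp (f : (ι → ZMod 2) → ℂ) (b : ι → ZMod 2) : amp (ofAmp f) b = f b := rfl

variable [DecidableEq ι]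

theorem inner_eq_sum_amp (ψ φ : Qubits ι) :
    inner ℂ ψ φ = ∑ b : ι → ZMod 2, (starRingEnd ℂ) (amp ψ b) * amp φ b := by
  rw [PiLp.inner_apply]
  refine Fintype.sum_equiv (Equiv.refl _) _ _ fun b => ?_
  rw [RCLike.inner_apply, mul_comm]
  rfl

theorem amp_tensorOp (A : ι → Matrix (Fin 2) (Fin 2) ℂ) (ψ : Qubits ι) (b : ι → ZMod 2) :
    amp (tensorOp A ψ) b = ∑ b' : ι → ZMod 2, (∏ i, A i (b i) (b' i)) * amp ψ b' := by
  rw [amp, tensorOp, Matrix.ofLp_toEuclideanCLM]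
  exact Fintype.sum_equiv (Equiv.refl _) _ _ fun b => rfl

theorem tensorOp_mul (A A' : ι → Matrix (Fin 2) (Fin 2) ℂ) :
    tensorOp A * tensorOp A' = tensorOp (fun i => A i * A' i) := by
  rw [tensorOp, tensorOp, tensorOp, ← map_mul]
  congr 1
  ext b b'
  simp only [Matrix.mul_apply, Matrix.of_apply, ← Finset.prod_mul_distrib]
  rw [Finset.prod_univ_sum, Fintype.piFinset_univ]

theorem amp_pauliX (v : ι → ZMod 2) (ψ : Qubits ι) (b : ι → ZMod 2) :
    amp (pauliX v ψ) b = amp ψ (b + v) := by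
  rw [pauliX, amp_tensorOp, Finset.sum_eq_single (b + v)]
  · rw [Finset.prod_eq_one, one_mul]
    intro i _
    have key : ∀ s t : ZMod 2, (if s = 0 then 1 else !![0, 1; 1, 0] : Matrix (Fin 2) (Fin 2) ℂ)
        t (t + s : ZMod 2) = 1 := by
      intro s t; fin_cases s <;> fin_cases t <;> rfl
    exact key (v i) (b i)
  · intro b' _ hb'
    obtain ⟨i, hi⟩ := Function.ne_iff.mp hb'
    rw [Finset.prod_eq_zero (Finset.mem_univ i), zero_mul]
    have key : ∀ s t u : ZMod 2, u ≠ t + s →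
        (if s = 0 then 1 else !![0, 1; 1, 0] : Matrix (Fin 2) (Fin 2) ℂ) t u = 0 := by
      intro s t u hu
      fin_cases s <;> fin_cases t <;> fin_cases u <;> first | rfl | exact absurd rfl hu
    exact key (v i) (b i) (b' i) hi
  · simp

theorem amp_pauliZ (v : ι → ZMod 2) (ψ : Qubits ι) (b : ι → ZMod 2) :
    amp (pauliZ v ψ) b = sgn (v ⬝ᵥ b) * amp ψ b := by
  rw [pauliZ, amp_tensorOp, Finset.sum_eq_single b]
  · rw [dotProduct, sgn_sum]
    congr 1
    refine Finset.prod_congr rfl fun i _ => ?_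
    have key : ∀ s t : ZMod 2, (if s = 0 then 1 else !![1, 0; 0, -1] : Matrix (Fin 2) (Fin 2) ℂ)
        t t = sgn (s * t) := by
      intro s t; fin_cases s <;> fin_cases t <;> simp [sgn] <;> rfl
    exact key (v i) (b i)
  · intro b' _ hb'
    obtain ⟨i, hi⟩ := Function.ne_iff.mp hb'
    rw [Finset.prod_eq_zero (Finset.mem_univ i), zero_mul]
    have key : ∀ s t u : ZMod 2, u ≠ t →
        (if s = 0 then 1 else !![1, 0; 0, -1] : Matrix (Fin 2) (Fin 2) ℂ) t u = 0 := by
      intro s t u hu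
      fin_cases s <;> fin_cases t <;> fin_cases u <;> first | rfl | exact absurd rfl hu
    exact key (v i) (b i) (b' i) hi
  · simp

theorem pauliX_pauliX (u v : ι → ZMod 2) (ψ : Qubits ι) :
    pauliX u (pauliX v ψ) = pauliX (u + v) ψ := by
  refine amp_ext fun b => ?_
  rw [amp_pauliX, amp_pauliX, amp_pauliX, add_assoc]

theorem pauliZ_pauliZ (u v : ι → ZMod 2) (ψ : Qubits ι) :
    pauliZ u (pauliZ v ψ) = pauliZ (u + v) ψ := by
  refine amp_ext fun b => ?_
  rw [amp_pauliZ, amp_pauliZ, amp_pauliZ, add_dotProduct, sgn_add, mul_assoc]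

theorem pauliX_zero (ψ : Qubits ι) : pauliX 0 ψ = ψ :=
  amp_ext fun b => by rw [amp_pauliX, add_zero]

theorem pauliZ_zero (ψ : Qubits ι) : pauliZ 0 ψ = ψ :=
  amp_ext fun b => by rw [amp_pauliZ, zero_dotProduct, sgn_zero, one_mul]

theorem pauliX_pauliZ (u v : ι → ZMod 2) (ψ : Qubits ι) :
    pauliX u (pauliZ v ψ) = sgn (v ⬝ᵥ u) • pauliZ v (pauliX u ψ) := by
  refine amp_ext fun b => ?_
  rw [amp_smul, amp_pauliX, amp_pauliZ, amp_pauliZ, amp_pauliX, dotProduct_add, sgn_add]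
  ring

theorem pauliZ_pauliX (u v : ι → ZMod 2) (ψ : Qubits ι) :
    pauliZ v (pauliX u ψ) = sgn (v ⬝ᵥ u) • pauliX u (pauliZ v ψ) := by
  rw [pauliX_pauliZ, smul_smul, sgn_mul_self, one_smul]

theorem inner_pauliX (v : ι → ZMod 2) (ψ φ : Qubits ι) :
    inner ℂ (pauliX v ψ) φ = inner ℂ ψ (pauliX v φ) := by
  rw [inner_eq_sum_amp, inner_eq_sum_amp]
  refine Fintype.sum_equiv (Equiv.addRight v) _ _ fun b => ?_
  rw [amp_pauliX, amp_pauliX, Equiv.coe_addRight, add_assoc, ZModModule.add_self, add_zero]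

theorem inner_pauliZ (v : ι → ZMod 2) (ψ φ : Qubits ι) :
    inner ℂ (pauliZ v ψ) φ = inner ℂ ψ (pauliZ v φ) := by
  rw [inner_eq_sum_amp, inner_eq_sum_amp]
  refine Finset.sum_congr rfl fun b _ => ?_
  rw [amp_pauliZ, amp_pauliZ, map_mul, conj_sgn]
  ring

end Pauli

/-! ### Joint eigenspaces of the stabilizer generators -/

namespace CSSCode

variable {MX MZ ι : Type*} [Fintype ι] [DecidableEq ι]

/-- The states on which each generator `S` acts by the sign given by the syndrome `σ`. -/
def syndromeSpace (Q : CSSCode MX MZ ι) (σ : MX ⊕ MZ → ZMod 2) : Submodule ℂ (Qubits ι) where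
  carrier := {ψ | ∀ s, Q.generator s ψ = sgn (σ s) • ψ}
  add_mem' := by
    intro a b ha hb s
    rw [map_add, ha s, hb s, smul_add]
  zero_mem' := fun s => by rw [map_zero, smul_zero]
  smul_mem' := by
    intro r a ha s
    rw [map_smul, ha s, smul_comm]

theorem inner_generator (Q : CSSCode MX MZ ι) (s : MX ⊕ MZ) (ψ φ : Qubits ι) :
    inner ℂ (Q.generator s ψ) φ = inner ℂ ψ (Q.generator s φ) := by
  cases s
  · exact inner_pauliX _ _ _
  · exact inner_pauliZ _ _ _

theorem isSelfAdjoint_generator (Q : CSSCode MX MZ ι) (s : MX ⊕ MZ) :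
    IsSelfAdjoint (Q.generator s) :=
  ContinuousLinearMap.isSelfAdjoint_iff_isSymmetric.mpr (Q.inner_generator s)

theorem generator_generator (Q : CSSCode MX MZ ι) (s : MX ⊕ MZ) (ψ : Qubits ι) :
    Q.generator s (Q.generator s ψ) = ψ := by
  cases s
  · exact (pauliX_pauliX _ _ _).trans (by rw [ZModModule.add_self, pauliX_zero])
  · exact (pauliZ_pauliZ _ _ _).trans (by rw [ZModModule.add_self, pauliZ_zero])

omit [DecidableEq ι] in
theorem hX_dotProduct_hZ (Q : CSSCode MX MZ ι) (i : MX) (j : MZ) : Q.hX i ⬝ᵥ Q.hZ j = 0 :=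
  congrFun (congrFun Q.comm i) j

theorem generator_comm (Q : CSSCode MX MZ ι) (s t : MX ⊕ MZ) (ψ : Qubits ι) :
    Q.generator s (Q.generator t ψ) = Q.generator t (Q.generator s ψ) := by
  rcases s with i | i <;> rcases t with j | j
  · exact (pauliX_pauliX _ _ _).trans ((congrArg (pauliX · ψ) (add_comm _ _)).trans
      (pauliX_pauliX _ _ _).symm)
  · refine (pauliX_pauliZ _ _ _).trans ?_
    rw [dotProduct_comm, Q.hX_dotProduct_hZ, sgn_zero, one_smul]
    rfl
  · refine (pauliZ_pauliX _ _ _).trans ?_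
    rw [dotProduct_comm, Q.hX_dotProduct_hZ, sgn_zero, one_smul]
    rfl
  · exact (pauliZ_pauliZ _ _ _).trans ((congrArg (pauliZ · ψ) (add_comm _ _)).trans
      (pauliZ_pauliZ _ _ _).symm)

theorem inner_eq_zero_of_mem_syndromeSpace {Q : CSSCode MX MZ ι} {σ τ : MX ⊕ MZ → ZMod 2}
    (h : σ ≠ τ) {ψ φ : Qubits ι} (hψ : ψ ∈ Q.syndromeSpace σ) (hφ : φ ∈ Q.syndromeSpace τ) :
    inner ℂ ψ φ = 0 := by
  obtain ⟨s, hs⟩ := Function.ne_iff.mp h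
  have key := Q.inner_generator s ψ φ
  rw [hψ s, hφ s, inner_smul_left, inner_smul_right, conj_sgn] at key
  by_contra h0
  exact hs (sgn_injective (mul_right_cancel₀ h0 key))

/-- Commuting symmetric operators are jointly diagonalisable, and each generator is an involution,
so its eigenvalues are signs. -/
theorem iSup_syndromeSpace (Q : CSSCode MX MZ ι) : ⨆ σ, Q.syndromeSpace σ = ⊤ := by
  have hT := LinearMap.IsSymmetric.iSup_iInf_eq_top_of_commute
    (T := fun s => (Q.generator s : Qubits ι →ₗ[ℂ] Qubits ι)) (fun s => Q.inner_generator s)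
    (fun s t _ => LinearMap.ext fun ψ => Q.generator_comm s t ψ)
  rw [eq_top_iff, ← hT]
  refine iSup_le fun χ ψ hψ => ?_
  have hψ' : ∀ s, Q.generator s ψ = χ s • ψ := fun s =>
    Module.End.mem_eigenspace_iff.mp ((Submodule.mem_iInf _).mp hψ s)
  by_cases h0 : ψ = 0
  · rw [h0]; exact Submodule.zero_mem _
  have hχ : ∀ s, ∃ a, sgn a = χ s := by
    intro s
    refine exists_sgn_eq (smul_left_injective ℂ h0 ?_)
    have := Q.generator_generator s ψ
    rw [hψ' s, map_smul, hψ' s, smul_smul] at this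
    simpa using this
  choose σ hσ using hχ
  refine Submodule.mem_iSup_of_mem σ fun s => ?_
  rw [hσ, hψ']

theorem exists_sum_syndromeSpace [Fintype MX] [Fintype MZ] [DecidableEq MX] [DecidableEq MZ]
    (Q : CSSCode MX MZ ι) (ψ : Qubits ι) :
    ∃ f : (MX ⊕ MZ → ZMod 2) → Qubits ι, (∀ σ, f σ ∈ Q.syndromeSpace σ) ∧ ∑ σ, f σ = ψ := by
  have hψ : ψ ∈ ⨆ σ, Q.syndromeSpace σ := by rw [iSup_syndromeSpace]; trivial
  induction hψ using Submodule.iSup_induction' with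
  | mem σ φ hφ =>
    refine ⟨Pi.single σ φ, fun τ => ?_, by simp⟩
    rcases eq_or_ne τ σ with rfl | h
    · rwa [Pi.single_eq_same]
    · rw [Pi.single_eq_of_ne h]
      exact Submodule.zero_mem _
  | zero => exact ⟨0, fun _ => Submodule.zero_mem _, by simp⟩
  | add φ φ' _ _ h h' =>
    obtain ⟨f, hf, rfl⟩ := h
    obtain ⟨g, hg, rfl⟩ := h'
    exact ⟨f + g, fun σ => Submodule.add_mem _ (hf σ) (hg σ), Finset.sum_add_distrib⟩

/-- Extends the eigenvalue relation from rows to the row space. A linear dependency among the rows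
then constrains `σ`. -/
theorem pauliX_vecMul [Fintype MX] (Q : CSSCode MX MZ ι) {σ : MX → ZMod 2} {ψ : Qubits ι}
    (h : ∀ i, pauliX (Q.hX i) ψ = sgn (σ i) • ψ) (u : MX → ZMod 2) :
    pauliX (Matrix.vecMul u Q.hX) ψ = sgn (u ⬝ᵥ σ) • ψ := by
  classical
  rw [Matrix.vecMul_eq_sum, dotProduct]
  induction (Finset.univ : Finset MX) using Finset.induction_on with
  | empty => rw [Finset.sum_empty, Finset.sum_empty, pauliX_zero, sgn_zero, one_smul]
  | insert i s hi ih =>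
    rw [Finset.sum_insert hi, Finset.sum_insert hi, ← pauliX_pauliX, ih, map_smul, sgn_add,
      mul_comm, mul_smul]
    congr 1
    have h2 : ∀ a : ZMod 2, a = 0 ∨ a = 1 := by decide
    rcases h2 (u i) with hu | hu
    · rw [hu, zero_smul, zero_mul, pauliX_zero, sgn_zero, one_smul]
    · rw [hu, one_smul, one_mul, h]

end CSSCode

/-- Linear duality: a vector outside the column space is separated from it by a functional, whose
coefficients form a dependency among the rows. -/
theorem Matrix.mem_range_mulVec_of_forall_dotProduct {M ι : Type*} [Fintype M] [Fintype ι]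
    (A : Matrix M ι (ZMod 2)) {σ : M → ZMod 2}
    (h : ∀ u : M → ZMod 2, Matrix.vecMul u A = 0 → u ⬝ᵥ σ = 0) : ∃ b, A.mulVec b = σ := by
  classical
  by_contra hσ
  have hσ' : σ ∉ LinearMap.range A.mulVecLin := fun ⟨b, hb⟩ => hσ ⟨b, hb⟩
  obtain ⟨f, hf, hA⟩ := Submodule.exists_le_ker_of_notMem hσ'
  have hfdot : ∀ x, f x = (fun i => f (Pi.single i 1)) ⬝ᵥ x := by
    intro x
    conv_lhs => rw [LinearMap.pi_apply_eq_sum_univ f x]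
    simp only [dotProduct, smul_eq_mul]
    refine Finset.sum_congr rfl fun i _ => ?_
    rw [mul_comm]
    congr 2
    ext j
    simp [Pi.single_apply, eq_comm]
  refine hf ?_
  rw [hfdot]
  refine h _ ?_
  refine dotProduct_eq_zero _ fun b => ?_
  rw [← Matrix.dotProduct_mulVec, ← hfdot]
  exact hA ⟨b, rfl⟩

/-! ### Syndromes realised by Pauli errors -/

namespace CSSCode

variable {MX MZ ι : Type*} [Fintype ι] [DecidableEq ι]

/-- Any basis vector in the support of the state has the right Z-syndrome. The X-syndrome respects
every dependency among the rows of `hX`, since the corresponding product of generators is the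
identity, so duality realises it. -/
theorem exists_errors_of_mem_syndromeSpace [Fintype MX] {Q : CSSCode MX MZ ι}
    {σ : MX ⊕ MZ → ZMod 2} {ψ : Qubits ι} (hψ : ψ ∈ Q.syndromeSpace σ) (h0 : ψ ≠ 0) :
    ∃ a b : ι → ZMod 2, σ = Sum.elim (Q.hX.mulVec b) (Q.hZ.mulVec a) := by
  obtain ⟨a, ha⟩ : ∃ a, amp ψ a ≠ 0 := by
    by_contra! h
    exact h0 (amp_ext h)
  obtain ⟨b, hb⟩ : ∃ b, Q.hX.mulVec b = fun i => σ (.inl i) := by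
    refine Matrix.mem_range_mulVec_of_forall_dotProduct _ fun u hu => ?_
    have := Q.pauliX_vecMul (fun i => hψ (.inl i)) u
    rw [hu, pauliX_zero] at this
    refine sgn_injective (smul_left_injective ℂ h0 ?_)
    simpa [sgn_zero] using this.symm
  refine ⟨a, b, funext ?_⟩
  rintro (i | j)
  · exact (congrFun hb i).symm
  · have h := congrArg (amp · a) (hψ (.inr j))
    have h' : sgn (Q.hZ j ⬝ᵥ a) * amp ψ a = sgn (σ (.inr j)) * amp ψ a :=
      (amp_pauliZ _ _ _).symm.trans h
    exact (sgn_injective (mul_right_cancel₀ ha h')).symm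

theorem mem_fattening_of_errors {Q : CSSCode MX MZ ι} {a b : ι → ZMod 2} {ψ : Qubits ι}
    (hψ : ψ ∈ Q.syndromeSpace (Sum.elim (Q.hX.mulVec b) (Q.hZ.mulVec a))) {t : ℕ}
    (ht : hammingNorm b + hammingNorm a ≤ t) : ψ ∈ fattening Q.codeSpace t := by
  have hop : tensorOp (fun i => (if b i = 0 then 1 else !![1, 0; 0, -1]) *
      (if a i = 0 then 1 else !![0, 1; 1, 0])) = pauliZ b * pauliX a :=
    (tensorOp_mul _ _).symm
  -- Undoing the error lands in the code space, and the reverse Pauli operator acts only on the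
  -- union of the supports of `a` and `b`.
  refine Submodule.subset_span ⟨_, le_trans ?_ ht, pauliX a (pauliZ b ψ), ?_,
    (congrArg (fun T : Qubits ι →L[ℂ] Qubits ι => T (pauliX a (pauliZ b ψ))) hop).trans ?_⟩
  · have hsub : {i | (if b i = 0 then (1 : Matrix (Fin 2) (Fin 2) ℂ) else !![1, 0; 0, -1]) *
        (if a i = 0 then 1 else !![0, 1; 1, 0]) ≠ 1} ⊆
        (((Finset.univ.filter fun i => b i ≠ 0) ∪ (Finset.univ.filter fun i => a i ≠ 0) :
          Finset ι) : Set ι) := by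
      intro i hi
      by_contra h
      simp only [Finset.coe_union, Finset.coe_filter, Finset.mem_univ, true_and, Set.mem_union,
        Set.mem_ofPred_eq, not_or, not_not] at h
      simp [h.1, h.2] at hi
    refine (Set.ncard_le_ncard hsub (Finset.finite_toSet _)).trans ?_
    rw [Set.ncard_coe_finset]
    exact Finset.card_union_le _ _
  · rintro (i | j)
    · have h : pauliX (Q.hX i) ψ = sgn (Q.hX i ⬝ᵥ b) • ψ := hψ (.inl i)
      change pauliX (Q.hX i) _ = _
      rw [pauliX_pauliX, add_comm, ← pauliX_pauliX, pauliX_pauliZ, h, map_smul, map_smul, map_smul,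
        smul_smul, dotProduct_comm b, sgn_mul_self, one_smul]
    · have h : pauliZ (Q.hZ j) ψ = sgn (Q.hZ j ⬝ᵥ a) • ψ := hψ (.inr j)
      change pauliZ (Q.hZ j) _ = _
      rw [pauliZ_pauliX, pauliZ_pauliZ, add_comm, ← pauliZ_pauliZ, h, map_smul, map_smul,
        smul_smul, sgn_mul_self, one_smul]
  · rw [mul_apply_eq_comp, pauliX_pauliX, ZModModule.add_self, pauliX_zero,
      pauliZ_pauliZ, ZModModule.add_self, pauliZ_zero]

/-! ### Dimension of the code space -/

theorem amp_eq_zero_of_notMem {Q : CSSCode MX MZ ι} {ψ : Qubits ι} (hψ : ψ ∈ Q.codeSpace)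
    {b : ι → ZMod 2} (hb : b ∉ kerCode Q.hZ) : amp ψ b = 0 := by
  obtain ⟨j, hj⟩ : ∃ j, Q.hZ j ⬝ᵥ b ≠ 0 := by
    by_contra! h
    exact hb (LinearMap.mem_ker.mpr (funext h))
  have h : sgn (Q.hZ j ⬝ᵥ b) * amp ψ b = amp ψ b :=
    (amp_pauliZ _ _ _).symm.trans (congrArg (amp · b) (hψ (.inr j)))
  rw [sgn, if_neg hj] at h
  linear_combination (-1 / 2 : ℂ) * h

theorem amp_add_vecMul [Fintype MX] {Q : CSSCode MX MZ ι} {ψ : Qubits ι} (hψ : ψ ∈ Q.codeSpace)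
    (b : ι → ZMod 2) (u : MX → ZMod 2) : amp ψ (b + Matrix.vecMul u Q.hX) = amp ψ b := by
  rw [← amp_pauliX, Q.pauliX_vecMul (σ := 0) (fun i => ?_) u, dotProduct_zero, sgn_zero, one_smul]
  rw [Pi.zero_apply, sgn_zero, one_smul]
  exact hψ (.inl i)

/-- A code state is supported on `ker hZ` and constant on cosets of the row space of `hX`, so it is
a free choice of one amplitude per coset; `φ` labels the cosets by `W`. -/
theorem finrank_codeSpace [Fintype MX] (Q : CSSCode MX MZ ι) {W : Type*} [AddCommGroup W]
    [Module (ZMod 2) W] [Fintype W] (φ : (ι → ZMod 2) →ₗ[ZMod 2] W)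
    (hsurj : ∀ w, ∃ x ∈ kerCode Q.hZ, φ x = w) (hrow : ∀ i, φ (Q.hX i) = 0)
    (hker : ∀ x ∈ kerCode Q.hZ, φ x = 0 → ∃ u, Matrix.vecMul u Q.hX = x) :
    Module.finrank ℂ Q.codeSpace = Fintype.card W := by
  classical
  choose r hr hφr using hsurj
  let L : Q.codeSpace →ₗ[ℂ] (W → ℂ) :=
    { toFun := fun ψ w => amp ψ.1 (r w)
      map_add' := fun _ _ => rfl
      map_smul' := fun _ _ => rfl }
  have hL : Function.Bijective L := by
    constructor
    · rw [← LinearMap.ker_eq_bot, LinearMap.ker_eq_bot']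
      rintro ⟨ψ, hψ⟩ h
      refine Subtype.ext (amp_ext fun b => ?_)
      by_cases hb : b ∈ kerCode Q.hZ
      -- `b` and the chosen representative of its class differ by a combination of X-rows, so they
      -- carry the same amplitude.
      · obtain ⟨u, hu⟩ := hker (b + r (φ b)) (Submodule.add_mem _ hb (hr _))
          (by rw [map_add, hφr, ZModModule.add_self])
        rw [← amp_add_vecMul hψ b u, hu, ← add_assoc, ZModModule.add_self, zero_add]
        exact congrFun h (φ b)
      · exact amp_eq_zero_of_notMem hψ hb
    · intro g
      refine ⟨⟨ofAmp fun b => if b ∈ kerCode Q.hZ then g (φ b) else 0, ?_⟩, ?_⟩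
      · rintro (i | j)
        · refine amp_ext fun b => (amp_pauliX _ _ _).trans ?_
          have hi : Q.hX i ∈ kerCode Q.hZ := by
            refine LinearMap.mem_ker.mpr (funext fun j => ?_)
            exact (dotProduct_comm _ _).trans (Q.hX_dotProduct_hZ i j)
          rw [amp_ofAmp, amp_ofAmp, map_add, hrow, add_zero]
          simp only [Submodule.add_mem_iff_left _ hi]
        · refine amp_ext fun b => (amp_pauliZ _ _ _).trans ?_
          rw [amp_ofAmp]
          by_cases hb : b ∈ kerCode Q.hZ
          · rw [show Q.hZ j ⬝ᵥ b = 0 from congrFun (LinearMap.mem_ker.mp hb) j, sgn_zero, one_mul]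
          · rw [if_neg hb, mul_zero]
      · funext w
        refine (if_pos (hr w)).trans ?_
        rw [hφr]
  rw [(LinearEquiv.ofBijective L hL).finrank_eq, Module.finrank_fintype_fun_eq_card]

end CSSCode

/-! ### Quantum soundness from classical soundness -/

/-- Summation by parts: it turns the distance operator into a sum, over radii, of the mass outside
each fattening. -/
theorem sum_Icc_mul_sub (P : ℕ → ℝ) (N : ℕ) :
    ∑ t ∈ Finset.Icc 1 N, (t : ℝ) * (P t - P (t - 1)) = ∑ t ∈ Finset.range N, (P N - P t) := by
  induction N with
  | zero => simp
  | succ N ih =>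
    rw [Finset.sum_Icc_succ_top (Nat.le_add_left 1 N), ih, Finset.sum_range_succ]
    simp only [Finset.sum_sub_distrib, Finset.sum_const, Finset.card_range, nsmul_eq_mul,
      Nat.add_sub_cancel]
    push_cast
    ring

section InnerProduct

variable {E κ : Type*} [NormedAddCommGroup E] [InnerProductSpace ℂ E] [Fintype κ]

theorem norm_sq_sub_norm_sq_starProjection_le (K : Submodule ℂ E) [K.HasOrthogonalProjection]
    (x : E) {y : E} (hy : y ∈ K) : ‖x‖ ^ 2 - ‖K.starProjection x‖ ^ 2 ≤ ‖x - y‖ ^ 2 := by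
  have h1 := Submodule.norm_sq_eq_add_norm_sq_starProjection x K
  have h2 := Submodule.norm_sq_eq_add_norm_sq_starProjection (x - y) K
  have h3 : Kᗮ.starProjection (x - y) = Kᗮ.starProjection x := by
    rw [map_sub, Submodule.starProjection_orthogonal_apply_eq_zero hy, sub_zero]
  rw [h3] at h2
  nlinarith [sq_nonneg ‖K.starProjection (x - y)‖]

theorem inner_sum_smul_sum {f : κ → E} (hf : Pairwise fun σ τ => inner ℂ (f σ) (f τ) = 0)
    (r : κ → ℝ) : (inner ℂ (∑ σ, (r σ : ℂ) • f σ) (∑ σ, f σ)).re = ∑ σ, r σ * ‖f σ‖ ^ 2 := by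
  rw [sum_inner, Complex.re_sum]
  refine Finset.sum_congr rfl fun σ _ => ?_
  rw [inner_sum, Finset.sum_eq_single σ (fun τ _ h => ?_) (by simp), inner_smul_left,
    Complex.conj_ofReal, Complex.re_ofReal_mul, inner_self_eq_norm_sq_to_K]
  · norm_cast
  · rw [inner_smul_left, hf h.symm, mul_zero]

theorem norm_sq_sum {f : κ → E} (hf : Pairwise fun σ τ => inner ℂ (f σ) (f τ) = 0) :
    ‖∑ σ, f σ‖ ^ 2 = ∑ σ, ‖f σ‖ ^ 2 := by
  have h := inner_sum_smul_sum hf fun _ => 1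
  simp only [Complex.ofReal_one, one_smul, one_mul] at h
  rw [← h, inner_self_eq_norm_sq_to_K]
  norm_cast

end InnerProduct

/-- The mass outside the `t`-fattening is at most that of the components with `δ σ > t`. Summed over
`t`, a component is counted at most `δ σ` times. -/
theorem re_inner_distanceOp_le {ι κ : Type*} [Fintype ι] [DecidableEq ι] [Fintype κ]
    (S : Submodule ℂ (Qubits ι)) {f : κ → Qubits ι}
    (hf : Pairwise fun σ τ => inner ℂ (f σ) (f τ) = 0) (δ : κ → ℕ)
    (hδ : ∀ σ t, δ σ ≤ t → f σ ∈ fattening S t) :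
    (inner ℂ (distanceOp S (∑ σ, f σ)) (∑ σ, f σ)).re ≤ ∑ σ, (δ σ : ℝ) * ‖f σ‖ ^ 2 := by
  classical
  set ψ := ∑ σ, f σ with hψ
  let P : ℕ → ℝ := fun t => ‖(fattening S t).starProjection ψ‖ ^ 2
  have hP : ∀ t, (inner ℂ ((fattening S t).starProjection ψ) ψ).re = P t := fun t =>
    Submodule.re_inner_starProjection_eq_normSq (K := fattening S t) ψ
  have hPle : ∀ t, P t ≤ ‖ψ‖ ^ 2 := fun t => by
    have := Submodule.norm_sq_eq_add_norm_sq_starProjection ψ (fattening S t)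
    have h0 := sq_nonneg ‖(fattening S t)ᗮ.starProjection ψ‖
    change P t ≤ _
    linarith
  have hPge : ∀ t, ‖ψ‖ ^ 2 - P t ≤ ∑ σ, if t < δ σ then ‖f σ‖ ^ 2 else 0 := by
    intro t
    refine (norm_sq_sub_norm_sq_starProjection_le (fattening S t) ψ
      -- The projection is at least as good an approximation as the part of `ψ` already known to lie
      -- in the fattening.
      (y := ∑ σ, if t < δ σ then 0 else f σ) (Submodule.sum_mem _ fun σ _ => ?_)).trans_eq ?_
    · split_ifs with h
      · exact Submodule.zero_mem _
      · exact hδ σ t (not_lt.mp h)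
    · rw [hψ, ← Finset.sum_sub_distrib, norm_sq_sum]
      · refine Finset.sum_congr rfl fun σ _ => ?_
        split_ifs <;> simp
      · intro σ τ h
        split_ifs <;> simp [hf h]
  have hD : (inner ℂ (distanceOp S ψ) ψ).re =
      ∑ t ∈ Finset.Icc 1 (Fintype.card ι), (t : ℝ) * (P t - P (t - 1)) := by
    rw [distanceOp, sum_apply, sum_inner, Complex.re_sum]
    refine Finset.sum_congr rfl fun t _ => ?_
    rw [smul_apply, sub_apply, inner_smul_left,
      inner_sub_left, ← hP, ← hP]
    simp
  rw [hD, sum_Icc_mul_sub]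
  calc ∑ t ∈ Finset.range (Fintype.card ι), (P (Fintype.card ι) - P t)
      ≤ ∑ t ∈ Finset.range (Fintype.card ι), ∑ σ, if t < δ σ then ‖f σ‖ ^ 2 else 0 :=
        Finset.sum_le_sum fun t _ => (sub_le_sub_right (hPle _) _).trans (hPge t)
    _ = ∑ σ, (((Finset.range (Fintype.card ι)).filter (· < δ σ)).card : ℝ) * ‖f σ‖ ^ 2 := by
        rw [Finset.sum_comm]
        refine Finset.sum_congr rfl fun σ _ => ?_
        rw [← Finset.sum_filter, Finset.sum_const, nsmul_eq_mul]
    _ ≤ _ := by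
        refine Finset.sum_le_sum fun σ _ => mul_le_mul_of_nonneg_right ?_ (sq_nonneg _)
        norm_cast
        calc _ ≤ (Finset.range (δ σ)).card := Finset.card_le_card fun t ht => by
              simp only [Finset.mem_filter, Finset.mem_range] at ht ⊢
              exact ht.2
          _ = δ σ := Finset.card_range _

namespace CSSCode

variable {MX MZ ι : Type*} [Fintype MX] [Fintype MZ] [Fintype ι] [DecidableEq ι]

theorem re_inner_energy (Q : CSSCode MX MZ ι) {f : (MX ⊕ MZ → ZMod 2) → Qubits ι}
    (hf : ∀ σ, f σ ∈ Q.syndromeSpace σ) [Fintype (MX ⊕ MZ → ZMod 2)] :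
    (inner ℂ ((∑ s, (1 / 2 : ℂ) • (1 - Q.generator s)) (∑ σ, f σ)) (∑ σ, f σ)).re =
      ∑ σ, (hammingNorm σ : ℝ) * ‖f σ‖ ^ 2 := by
  have horth : Pairwise fun σ τ => inner ℂ (f σ) (f τ) = 0 := fun σ τ h =>
    inner_eq_zero_of_mem_syndromeSpace h (hf σ) (hf τ)
  rw [← inner_sum_smul_sum horth, map_sum]
  congr 2
  refine Finset.sum_congr rfl fun σ _ => ?_
  rw [sum_apply, hammingNorm_eq_sum, Complex.ofReal_natCast, Nat.cast_sum, Finset.sum_smul]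
  refine Finset.sum_congr rfl fun s _ => ?_
  rw [smul_apply, sub_apply, hf σ s,
    one_apply_eq_self,
    show f σ - sgn (σ s) • f σ = (1 - sgn (σ s)) • f σ by rw [sub_smul, one_smul], smul_smul]
  congr 1
  by_cases h : σ s = 0 <;> norm_num [sgn, h]

theorem isPositive_of_soundness [DecidableEq MX] [DecidableEq MZ] (Q : CSSCode MX MZ ι)
    {α β : ℝ} (hα : 0 ≤ α) (hβ : 0 ≤ β)
    (h : ∀ a b : ι → ZMod 2, α * (distTo b (kerCode Q.hX) + distTo a (kerCode Q.hZ) : ℝ) ≤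
      β * (hammingNorm (Q.hX.mulVec b) + hammingNorm (Q.hZ.mulVec a) : ℝ)) :
    ((β : ℂ) • ∑ s, (1 / 2 : ℂ) • (1 - Q.generator s)
      - (α : ℂ) • distanceOp Q.codeSpace).IsPositive := by
  constructor
  · rw [← ContinuousLinearMap.isSelfAdjoint_iff_isSymmetric]
    have hreal : ∀ r : ℝ, IsSelfAdjoint (r : ℂ) := fun r => Complex.conj_ofReal r
    refine IsSelfAdjoint.sub ((hreal β).smul ?_) ((hreal α).smul ?_)
    · refine isSelfAdjoint_sum _ fun s _ => IsSelfAdjoint.smul ?_ ?_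
      · simp
      · exact (IsSelfAdjoint.one _).sub (Q.isSelfAdjoint_generator s)
    · refine isSelfAdjoint_sum _ fun t _ => IsSelfAdjoint.smul ?_ ?_
      · simp
      · exact (isSelfAdjoint_starProjection _).sub (isSelfAdjoint_starProjection _)
  · intro ψ
    obtain ⟨f, hf, rfl⟩ := Q.exists_sum_syndromeSpace ψ
    have horth : Pairwise fun σ τ => inner ℂ (f σ) (f τ) = 0 := fun σ τ h =>
      inner_eq_zero_of_mem_syndromeSpace h (hf σ) (hf τ)
    have hδ : ∀ σ, ∃ δ : ℕ, (∀ t, δ ≤ t → f σ ∈ fattening Q.codeSpace t) ∧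
        α * δ ≤ β * hammingNorm σ := by
      intro σ
      -- A syndrome with no component need not come from any error, so its radius is set to 0.
      by_cases h0 : f σ = 0
      · refine ⟨0, fun t _ => by rw [h0]; exact Submodule.zero_mem _, ?_⟩
        rw [Nat.cast_zero, mul_zero]
        positivity
      obtain ⟨a, b, hab⟩ := exists_errors_of_mem_syndromeSpace (hf σ) h0
      obtain ⟨c, hc, hbc⟩ := exists_hammingNorm_eq_distTo b (kerCode Q.hX)
      obtain ⟨c', hc', hac⟩ := exists_hammingNorm_eq_distTo a (kerCode Q.hZ)
      -- Shifting each error by the nearest element of its kernel keeps the syndrome and makes the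
      -- weight equal to the distance.
      refine ⟨distTo b (kerCode Q.hX) + distTo a (kerCode Q.hZ), fun t ht => ?_, ?_⟩
      · refine mem_fattening_of_errors (a := a + c') (b := b + c) ?_ (by rwa [hbc, hac])
        rw [Matrix.mulVec_add, Matrix.mulVec_add, mem_kerCode.mp hc, mem_kerCode.mp hc', add_zero,
          add_zero, ← hab]
        exact hf σ
      · rw [hab, hammingNorm_sum_type]
        push_cast
        exact h a b
    choose δ hδ hle using hδ
    rw [ContinuousLinearMap.reApplyInnerSelf_apply, sub_apply, inner_sub_left,
      smul_apply, smul_apply, inner_smul_left,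
      inner_smul_left, Complex.conj_ofReal, Complex.conj_ofReal, map_sub]
    simp only [RCLike.re_to_complex, Complex.re_ofReal_mul]
    rw [Q.re_inner_energy hf, sub_nonneg]
    refine (mul_le_mul_of_nonneg_left (re_inner_distanceOp_le _ horth δ hδ) hα).trans ?_
    rw [Finset.mul_sum, Finset.mul_sum]
    refine Finset.sum_le_sum fun σ _ => ?_
    rw [← mul_assoc, ← mul_assoc]
    exact mul_le_mul_of_nonneg_right (hle σ) (sq_nonneg _)

end CSSCode

/-! ### Soundness of the star-balanced code -/

section Soundness

variable {n m p w : ℕ} {ρ : ℝ} {H : Matrix (Fin m) (Fin n) (ZMod 2)}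

theorem isLTC_starCode_hX (hn : 0 < n) (hp : 1 ≤ p) (hρ : 0 < ρ) (hH : IsLTC H ρ w) {K : ℕ}
    (hK : ∀ i, rowWeight (starCode H p).hX i ≤ K) :
    IsLTC (starCode H p).hX (1 / 3 * min ρ 1) K := by
  refine ⟨hK, fun q => ?_⟩
  have hD := exists_distTo_hX_le H q
  have hB := hammingNorm_mulVec_total_le H q
  have hT := hH.2 (StarWord.total q)
  set A := hammingNorm ((starCode H p).hX.mulVec q)
  set B := hammingNorm (H.mulVec (StarWord.total q))
  set T := distTo (StarWord.total q) (kerCode H)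
  set D := distTo q (kerCode (starCode H p).hX)
  simp only [Fintype.card_sum, Fintype.card_prod, Fintype.card_fin] at hT ⊢
  push_cast
  have hn' : (0 : ℝ) < n := by exact_mod_cast hn
  have hp' : (1 : ℝ) ≤ p := by exact_mod_cast hp
  have hr0 : 0 < min ρ 1 := lt_min hρ one_pos
  have hrρ : min ρ 1 ≤ ρ := min_le_left _ _
  have hr1 : min ρ 1 ≤ 1 := min_le_right _ _
  generalize min ρ 1 = r at *
  have hD' : (D : ℝ) ≤ A + T := by exact_mod_cast hD
  have hB' : (B : ℝ) ≤ A := by exact_mod_cast hB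
  have hT0 : (0 : ℝ) ≤ T := Nat.cast_nonneg _
  have hA0 : (0 : ℝ) ≤ A := Nat.cast_nonneg _
  -- Without checks the quotients by `m` are 0 by convention; the hypothesis then forces distance 0,
  -- and the claim becomes trivial.
  rcases Nat.eq_zero_or_pos m with rfl | hm
  · have hA : (A : ℝ) = 0 := by
      have : A ≤ Fintype.card (Fin 0 × Fin (p + 1)) := hammingNorm_le_card_fintype
      rw [Fintype.card_prod, Fintype.card_fin, zero_mul, Nat.le_zero] at this
      exact_mod_cast this
    rw [Nat.cast_zero, div_zero] at hT
    have hT' : (T : ℝ) ≤ 0 := nonpos_of_mul_nonpos_right hT (div_pos hρ hn')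
    have hD0 : (D : ℝ) = 0 := le_antisymm (by linarith) (Nat.cast_nonneg _)
    rw [hD0, hA, mul_zero, zero_div]
  · have hm' : (0 : ℝ) < m := by exact_mod_cast hm
    have hT' : ρ * T * m ≤ n * A := by
      rw [div_mul_eq_mul_div, div_le_div_iff₀ hn' hm'] at hT
      nlinarith
    rw [div_mul_eq_mul_div, div_le_div_iff₀ (by positivity) (by positivity)]
    have h1 : r * D * m ≤ (m + n) * A := by
      have h2 : r * D * m ≤ r * (A + T) * m := by gcongr
      have h3 : r * A * m ≤ 1 * A * m := by gcongr
      have h4 : r * T * m ≤ ρ * T * m := by gcongr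
      linarith
    have h5 : r * D * m * (p + 1) ≤ (m + n) * A * (p + 1) := by gcongr
    -- Here `p ≥ 1` matters: m(p + 1) ≤ 2mp lets the edge qubits pay for the X-generators.
    have h6 : 0 ≤ A * m * ((p : ℝ) - 1) := by
      have : (0 : ℝ) ≤ p - 1 := by linarith
      positivity
    have h7 : 0 ≤ A * (n : ℝ) * (p + 1) := by positivity
    have h8 : 0 ≤ A * (m : ℝ) := by positivity
    nlinarith

theorem isLTC_starCode_hZ (hn : 0 < n) {K : ℕ}
    (hK : ∀ i, rowWeight (starCode H p).hZ i ≤ K) :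
    IsLTC (starCode H p).hZ (1 / 3) K := by
  refine ⟨hK, fun q => ?_⟩
  have hD := distTo_hZ_le H q
  set A := hammingNorm ((starCode H p).hZ.mulVec q)
  set D := distTo q (kerCode (starCode H p).hZ)
  simp only [Fintype.card_sum, Fintype.card_prod, Fintype.card_fin]
  push_cast
  have hn' : (0 : ℝ) < n := by exact_mod_cast hn
  have hD' : (D : ℝ) ≤ 2 * A := by exact_mod_cast hD
  have hA0 : (0 : ℝ) ≤ A := Nat.cast_nonneg _
  rw [div_mul_eq_mul_div, div_le_div_iff₀ (by positivity) (by positivity)]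
  have h1 : (D : ℝ) * ((n + n) * p + n * (p + 1)) ≤ 2 * A * ((n + n) * p + n * (p + 1)) := by
    gcongr
  have h2 : 0 ≤ (A : ℝ) * n := by positivity
  have h3 : 0 ≤ (A : ℝ) * (m * p) := by positivity
  nlinarith

theorem mulVec_single_one_ne_zero {d : ℕ} (hd : 2 ≤ d)
    (hmin : IsLeast {t | ∃ c ∈ kerCode H, c ≠ 0 ∧ hammingNorm c = t} d) (j : Fin n) :
    H.mulVec (Pi.single j 1) ≠ 0 := by
  intro h
  have := hmin.2 ⟨Pi.single j 1, mem_kerCode.mpr h, by simp, hammingNorm_single_one j⟩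
  omega

theorem hammingNorm_mulVec_single_one (j : Fin n) :
    hammingNorm (H.mulVec (Pi.single j 1)) = colWeight H j := by
  rw [Matrix.mulVec_single_one]
  rfl

/-- Every bit is in some check, since a single bit is not a codeword; double counting the ones of H
gives the bound. -/
theorem card_bits_le {d : ℕ} (hd : 2 ≤ d) (hw : IsLDPC H w)
    (hmin : IsLeast {t | ∃ c ∈ kerCode H, c ≠ 0 ∧ hammingNorm c = t} d) : n ≤ w * m :=
  calc n = ∑ _j : Fin n, 1 := by simp
    _ ≤ ∑ j, colWeight H j := Finset.sum_le_sum fun j _ => by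
      rw [← hammingNorm_mulVec_single_one]
      exact hammingNorm_pos_iff.mpr (mulVec_single_one_ne_zero hd hmin j)
    _ = ∑ i, rowWeight H i := by
      simp only [colWeight, rowWeight, hammingNorm_eq_sum]
      exact Finset.sum_comm
    _ ≤ ∑ _i : Fin m, w := Finset.sum_le_sum fun i _ => hw.1 i
    _ = w * m := by simp [mul_comm]

/-- A single bit error is at distance at least 1 from the code but violates at most `w` checks. -/
theorem soundness_mul_le {d : ℕ} (hn : 0 < n) (hm : 0 < m) (hρ : 0 < ρ) (hd : 2 ≤ d)
    (hw : IsLDPC H w) (hH : IsLTC H ρ w)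
    (hmin : IsLeast {t | ∃ c ∈ kerCode H, c ≠ 0 ∧ hammingNorm c = t} d) : ρ * m ≤ w * n := by
  let j : Fin n := ⟨0, hn⟩
  have h := hH.2 (Pi.single j 1)
  rw [hammingNorm_mulVec_single_one, Fintype.card_fin, Fintype.card_fin,
    div_mul_eq_mul_div, div_le_div_iff₀ (by exact_mod_cast hn) (by exact_mod_cast hm)] at h
  have h1 : 1 ≤ distTo (Pi.single j 1) (kerCode H) := by
    refine Nat.one_le_iff_ne_zero.mpr fun h0 => mulVec_single_one_ne_zero hd hmin j ?_
    obtain ⟨c, hc, hjc⟩ := exists_hammingNorm_eq_distTo (Pi.single j 1) (kerCode H)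
    rw [h0, hammingNorm_eq_zero, add_eq_zero_iff_eq_zmodTwo] at hjc
    rw [hjc]
    exact mem_kerCode.mp hc
  have h2 : (1 : ℝ) ≤ distTo (Pi.single j 1) (kerCode H) := by exact_mod_cast h1
  have h3 : (colWeight H j : ℝ) ≤ w := by exact_mod_cast hw.2 j
  calc ρ * m = ρ * 1 * m := by ring
    _ ≤ ρ * distTo (Pi.single j 1) (kerCode H) * m := by gcongr
    _ ≤ colWeight H j * n := h
    _ ≤ w * n := by gcongr

end Soundness

/-- The classical soundness conditions average over one type of check, the quantum one over all; the
last two hypotheses are the exchange rate. -/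
theorem CSSCode.isQLTC_of_isLTC {MX MZ ι : Type*} [Fintype MX] [Fintype MZ] [Fintype ι]
    [DecidableEq ι] [DecidableEq MX] [DecidableEq MZ] [Nonempty MX] [Nonempty MZ]
    (Q : CSSCode MX MZ ι) {ρX ρZ ρ : ℝ} {K : ℕ} (hX : IsLTC Q.hX ρX K) (hZ : IsLTC Q.hZ ρZ K)
    (hρ : 0 ≤ ρ) (hρX : ρ * Fintype.card (MX ⊕ MZ) ≤ ρX * Fintype.card MX)
    (hρZ : ρ * Fintype.card (MX ⊕ MZ) ≤ ρZ * Fintype.card MZ) : Q.IsQLTC ρ K := by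
  refine ⟨?_, ?_⟩
  · rintro (i | j)
    · exact hX.1 i
    · exact hZ.1 j
  have hMX : (0 : ℝ) < Fintype.card MX := by exact_mod_cast Fintype.card_pos
  have hMZ : (0 : ℝ) < Fintype.card MZ := by exact_mod_cast Fintype.card_pos
  have hM : (0 : ℝ) < Fintype.card (MX ⊕ MZ) := by exact_mod_cast Fintype.card_pos
  have key : ∀ {σ D A M : ℝ}, 0 ≤ D → 0 < M → ρ * Fintype.card (MX ⊕ MZ) ≤ σ * M →
      σ / (Fintype.card ι : ℝ) * D ≤ A / M →
      ρ / (Fintype.card ι : ℝ) * D ≤ 1 / Fintype.card (MX ⊕ MZ) * A := by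
    intro σ D A M hD hM' hle h
    rw [le_div_iff₀ hM'] at h
    rw [one_div_mul_eq_div, le_div_iff₀ hM]
    refine le_trans ?_ h
    have : ρ * Fintype.card (MX ⊕ MZ) * (D / Fintype.card ι) ≤ σ * M * (D / Fintype.card ι) :=
      mul_le_mul_of_nonneg_right hle (by positivity)
    calc _ = ρ * Fintype.card (MX ⊕ MZ) * (D / Fintype.card ι) := by ring
      _ ≤ σ * M * (D / Fintype.card ι) := this
      _ = _ := by ring
  have h := Q.isPositive_of_soundness (α := ρ / Fintype.card ι)
    (β := 1 / Fintype.card (MX ⊕ MZ)) (by positivity) (by positivity) fun a b => by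
      rw [mul_add, mul_add]
      exact add_le_add (key (Nat.cast_nonneg _) hMX hρX (hX.2 b))
        (key (Nat.cast_nonneg _) hMZ hρZ (hZ.2 a))
  rwa [Complex.ofReal_div, Complex.ofReal_one, Complex.ofReal_natCast] at h

theorem isQLTC_starCode {n m p w d K : ℕ} {ρ : ℝ} {H : Matrix (Fin m) (Fin n) (ZMod 2)}
    (hn : 0 < n) (hp : 1 ≤ p) (hρ : 0 < ρ) (hd : 2 ≤ d) (hw : IsLDPC H w) (hH : IsLTC H ρ w)
    (hmin : IsLeast {t | ∃ c ∈ kerCode H, c ≠ 0 ∧ hammingNorm c = t} d)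
    (hKX : ∀ i, rowWeight (starCode H p).hX i ≤ K)
    (hKZ : ∀ i, rowWeight (starCode H p).hZ i ≤ K) :
    (starCode H p).IsQLTC (1 / (12 * (w + 1) ^ 3) * ρ) K := by
  have hnm := card_bits_le hd hw hmin
  have hm : 0 < m := Nat.pos_of_ne_zero fun h => by rw [h, mul_zero] at hnm; omega
  have hρm := soundness_mul_le hn hm hρ hd hw hH hmin
  have : Nonempty (Fin n) := ⟨⟨0, hn⟩⟩
  have : Nonempty (Fin m) := ⟨⟨0, hm⟩⟩
  have hn' : (0 : ℝ) < n := by exact_mod_cast hn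
  have hm' : (0 : ℝ) < m := by exact_mod_cast hm
  have hnm' : (n : ℝ) ≤ w * m := by exact_mod_cast hnm
  have hp0 : (0 : ℝ) ≤ p := Nat.cast_nonneg _
  -- Using w + 1 ensures `1 ≤ W`, so powers of `W` increase. The constant 12 W³ is the 3 of the
  -- classical soundness times W² from ρ ≤ W² min(ρ, 1) times 4W from m + 3n ≤ 4Wm.
  obtain ⟨W, hW⟩ : ∃ W : ℝ, W = w + 1 := ⟨_, rfl⟩
  have hW1 : 1 ≤ W := by rw [hW]; linarith [(Nat.cast_nonneg w : (0 : ℝ) ≤ w)]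
  have hwW : (w : ℝ) ≤ W := by rw [hW]; linarith
  have hnW : (n : ℝ) ≤ W * m := hnm'.trans (by gcongr)
  have hρW : ρ * m ≤ W * n := hρm.trans (by gcongr)
  have hρ2 : ρ ≤ W ^ 2 := by
    refine le_of_mul_le_mul_right ?_ hm'
    calc ρ * m ≤ W * n := hρW
      _ ≤ W * (W * m) := by gcongr
      _ = W ^ 2 * m := by ring
  have hr : ρ ≤ W ^ 2 * min ρ 1 := by
    rcases min_choice ρ 1 with h | h <;> rw [h]
    · nlinarith [one_le_pow₀ hW1 (n := 2)]
    · linarith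
  have hcard : (Fintype.card ((Fin m × Fin (p + 1)) ⊕
      (((Fin n ⊕ Fin n) × Fin p) ⊕ (Fin n × Fin (p + 1)))) : ℝ) ≤ (m + 3 * n) * (p + 1) := by
    simp only [Fintype.card_sum, Fintype.card_prod, Fintype.card_fin]
    push_cast
    nlinarith
  rw [← hW]
  refine CSSCode.isQLTC_of_isLTC _ (isLTC_starCode_hX hn hp hρ hH hKX)
    (isLTC_starCode_hZ hn hKZ) (by positivity) ?_ ?_
  · calc _ ≤ 1 / (12 * W ^ 3) * ρ * ((m + 3 * n) * (p + 1)) := by gcongr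
      _ ≤ 1 / (12 * W ^ 3) * (W ^ 2 * min ρ 1) * ((4 * W * m) * (p + 1)) := by
        have hr0 : 0 < min ρ 1 := lt_min hρ one_pos
        gcongr
        nlinarith
      _ = 1 / 3 * min ρ 1 * (m * (p + 1)) := by
        field_simp
        norm_num
      _ = _ := by simp
  · have h1 : ρ * (m + 3 * n) ≤ 4 * W ^ 2 * n := by
      have h2 : ρ * n ≤ W ^ 2 * n := by gcongr
      have h3 : W * n ≤ W ^ 2 * n := by gcongr; nlinarith
      linarith
    calc _ ≤ 1 / (12 * W ^ 3) * ρ * ((m + 3 * n) * (p + 1)) := by gcongr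
      _ = 1 / (12 * W ^ 3) * (ρ * (m + 3 * n)) * (p + 1) := by ring
      _ ≤ 1 / (12 * W ^ 2) * (4 * W ^ 2 * n) * (p + 1) := by
        gcongr
        norm_num
      _ = 1 / 3 * (n * (p + 1)) := by
        field_simp
        norm_num
      _ ≤ _ := by
        simp only [Fintype.card_sum, Fintype.card_prod, Fintype.card_fin]
        push_cast
        have : 0 ≤ (n : ℝ) * p := by positivity
        nlinarith

theorem hasParams_starCode {n m p k d : ℕ} {H : Matrix (Fin m) (Fin n) (ZMod 2)}
    (hC : HasParams (kerCode H) n k d) :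
    (starCode H p).HasParams (2 * n * (p + 1) + m * p) k (min d (2 * (p + 1))) := by
  classical
  refine ⟨?_, ?_, isLeast_logicalWeights H hC.2.2⟩
  · simp only [Fintype.card_sum, Fintype.card_prod, Fintype.card_fin]
    ring
  · have : Fintype ((Fin n → ZMod 2) ⧸ LinearMap.range H.transpose.mulVecLin) :=
      Fintype.ofFinite _
    rw [CSSCode.finrank_codeSpace _ (centreClass H p) (centreClass_surjective H)
      (centreClass_row H) fun x => exists_vecMul_of_centreClass_eq_zero H,
      card_quotient_range_transpose, hC.2.1]

/-! ### Weights of generators and degrees of qubits -/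

section WeightBounds

variable {n m p w : ℕ} {H : Matrix (Fin m) (Fin n) (ZMod 2)}

theorem rowWeight_starCode_hX_castSucc_le (hw : IsLDPC H w) (i : Fin m) (e : Fin p) :
    rowWeight (starCode H p).hX (i, e.castSucc) ≤ 2 * w + 3 := by
  rw [rowWeight_starCode_hX, rowWeight_starIncidence_castSucc]
  have := hw.1 i
  dsimp only
  omega

theorem rowWeight_starCode_hX_le (hw : IsLDPC H w) (i : Fin m × Fin (p + 1)) :
    rowWeight (starCode H p).hX i ≤ (2 * w + 3) * (p + 1) := by
  have hKp : 2 * w + 3 + p ≤ (2 * w + 3) * (p + 1) := by nlinarith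
  obtain ⟨i, v⟩ := i
  induction v using Fin.lastCases with
  | last =>
    rw [rowWeight_starCode_hX, rowWeight_starIncidence_last]
    have := hw.1 i
    dsimp only
    omega
  | cast e => exact (rowWeight_starCode_hX_castSucc_le hw i e).trans (by omega)

theorem exists_heavy_X_generators (hp : 1 ≤ p) (hw : IsLDPC H w) :
    ∃ S : Finset (Fin m × Fin (p + 1)), (p + 1) * S.card = Fintype.card (Fin m × Fin (p + 1)) ∧
      (∀ i ∈ S, p + 1 ≤ (2 * w + 3) * rowWeight (starCode H p).hX i ∧
        rowWeight (starCode H p).hX i ≤ (2 * w + 3) * (p + 1)) ∧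
      ∀ i ∉ S, rowWeight (starCode H p).hX i ≤ 2 * w + 3 := by
  -- The heavy generators sit at the centre of the star, the only vertex whose degree `p` grows with
  -- the star.
  refine ⟨Finset.univ ×ˢ {Fin.last p}, by simp [mul_comm], ?_, ?_⟩
  · rintro ⟨i, v⟩ hv
    obtain rfl : v = Fin.last p := Finset.mem_singleton.mp (Finset.mem_product.mp hv).2
    refine ⟨?_, rowWeight_starCode_hX_le hw _⟩
    rw [rowWeight_starCode_hX, rowWeight_starIncidence_last]
    nlinarith
  · rintro ⟨i, v⟩ hv
    induction v using Fin.lastCases with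
    | last => exact absurd (by simp) hv
    | cast e => exact rowWeight_starCode_hX_castSucc_le hw i e

theorem rowWeight_starCode_hZ_le (hw : IsLDPC H w)
    (i : ((Fin n ⊕ Fin n) × Fin p) ⊕ (Fin n × Fin (p + 1))) :
    rowWeight (starCode H p).hZ i ≤ 2 * w + 3 := by
  rcases i with i | i
  · rw [rowWeight_starCode_hZ_inl]
    have := hw.2 (i.1.elim id id)
    omega
  · rw [rowWeight_starCode_hZ_inr]
    omega

theorem exists_heavy_qubits (hw : IsLDPC H w) :
    ∃ T : Finset (((Fin n ⊕ Fin n) × Fin (p + 1)) ⊕ (Fin m × Fin p)),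
      (p + 1) * T.card ≤ Fintype.card (((Fin n ⊕ Fin n) × Fin (p + 1)) ⊕ (Fin m × Fin p)) ∧
      (∀ q ∈ T, p + 1 ≤ (2 * w + 3) * colWeight (starCode H p).hZ q ∧
        colWeight (starCode H p).hZ q ≤ (2 * w + 3) * (p + 1)) ∧
      ∀ q ∉ T, colWeight (starCode H p).hZ q ≤ 2 * w + 3 := by
  -- Again the centre blocks; edge qubits are all light, and they only lower the heavy fraction.
  refine ⟨(Finset.univ ×ˢ {Fin.last p}).disjSum ∅, ?_, ?_, ?_⟩
  · simp only [Finset.card_disjSum, Finset.card_product, Finset.card_univ, Finset.card_singleton,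
      Finset.card_empty, Fintype.card_sum, Fintype.card_prod, Fintype.card_fin]
    nlinarith
  · rintro (⟨a, v⟩ | q) hq
    · obtain rfl : v = Fin.last p :=
        Finset.mem_singleton.mp (Finset.mem_product.mp (Finset.inl_mem_disjSum.mp hq)).2
      rw [colWeight_starCode_hZ_inl, rowWeight_starIncidence_last]
      exact ⟨Nat.le_mul_of_pos_left _ (by omega), Nat.le_mul_of_pos_left _ (by omega)⟩
    · simp at hq
  · rintro (⟨a, v⟩ | q) hq
    · induction v using Fin.lastCases with
      | last =>
        simp only [Finset.inl_mem_disjSum, Finset.mem_product, Finset.mem_univ,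
          Finset.mem_singleton, and_self, not_true_eq_false] at hq
      | cast e =>
        rw [colWeight_starCode_hZ_inl, rowWeight_starIncidence_castSucc]
        omega
    · rw [colWeight_starCode_hZ_inr]
      have := hw.1 q.1
      omega

theorem colWeight_starCode_hX_le (hw : IsLDPC H w)
    (q : ((Fin n ⊕ Fin n) × Fin (p + 1)) ⊕ (Fin m × Fin p)) :
    colWeight (starCode H p).hX q ≤ 2 * w + 3 := by
  rcases q with q | q
  · rw [colWeight_starCode_hX_inl]
    have := hw.2 (q.1.elim id id)
    omega
  · rw [colWeight_starCode_hX_inr]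
    omega

end WeightBounds

theorem mainTheorem2 :
    ∃ c₀ : ℝ, 0 < c₀ ∧ ∀ w : ℕ, ∃ (c : ℝ) (K : ℕ), 0 < c ∧
      ∀ (ℓ n m k d : ℕ) (ρ : ℝ) (H : Matrix (Fin m) (Fin n) (ZMod 2)),
        2 ≤ ℓ → 0 < ρ → IsLDPC H w → HasParams (kerCode H) n k d → IsLTC H ρ w →
        -- parameters
        (starBalanced H ℓ).HasParams (2 * n * ℓ + m * (ℓ - 1)) k (min d (2 * ℓ)) ∧
        -- quantum soundness, and soundness of the two classical component codes
        (2 ≤ d → (starBalanced H ℓ).IsQLTC (c * ρ) (K * ℓ)) ∧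
        IsLTC (starBalanced H ℓ).hX (c₀ * min ρ 1) (K * ℓ) ∧
        IsLTC (starBalanced H ℓ).hZ c₀ (K * ℓ) ∧
        -- weights of the X-generators
        (∃ S : Finset (Fin m × Fin ℓ), ℓ * S.card = Fintype.card (Fin m × Fin ℓ) ∧
          (∀ i ∈ S, ℓ ≤ K * rowWeight (starBalanced H ℓ).hX i ∧
            rowWeight (starBalanced H ℓ).hX i ≤ K * ℓ) ∧
          ∀ i ∉ S, rowWeight (starBalanced H ℓ).hX i ≤ K) ∧
        -- weights of the Z-generators
        (∀ i, rowWeight (starBalanced H ℓ).hZ i ≤ K) ∧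
        -- number of Z-generators at each qubit
        (∃ T : Finset (((Fin n ⊕ Fin n) × Fin ℓ) ⊕ (Fin m × Fin (ℓ - 1))),
          ℓ * T.card ≤ Fintype.card (((Fin n ⊕ Fin n) × Fin ℓ) ⊕ (Fin m × Fin (ℓ - 1))) ∧
          (∀ q ∈ T, ℓ ≤ K * colWeight (starBalanced H ℓ).hZ q ∧
            colWeight (starBalanced H ℓ).hZ q ≤ K * ℓ) ∧
          ∀ q ∉ T, colWeight (starBalanced H ℓ).hZ q ≤ K) ∧
        -- number of X-generators at each qubit
        (∀ q, colWeight (starBalanced H ℓ).hX q ≤ K) := by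
  refine ⟨1 / 3, by norm_num, fun w => ⟨1 / (12 * (w + 1) ^ 3), 2 * w + 3, by positivity, ?_⟩⟩
  intro ℓ n m k d ρ H hℓ hρ hw hC hH
  -- With ℓ = p + 1 the edge index `Fin (ℓ - 1)` is definitionally `Fin p`, so the results on
  -- `starCode` apply verbatim.
  obtain ⟨p, rfl⟩ : ∃ p, ℓ = p + 1 := ⟨ℓ - 1, by omega⟩
  have hp : 1 ≤ p := by omega
  have hn : 0 < n := by
    obtain ⟨c, -, hc, -⟩ := hC.2.2.1
    obtain ⟨j, -⟩ := Function.ne_iff.mp hc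
    exact j.pos
  have hX := rowWeight_starCode_hX_le (p := p) hw
  have hZ := rowWeight_starCode_hZ_le (p := p) hw
  have hZ' : ∀ i, rowWeight (starCode H p).hZ i ≤ (2 * w + 3) * (p + 1) := fun i =>
    (hZ i).trans (Nat.le_mul_of_pos_right _ p.succ_pos)
  exact ⟨hasParams_starCode hC, fun hd => isQLTC_starCode hn hp hρ hd hw hH hC.2.2 hX hZ',
    isLTC_starCode_hX hn hp hρ hH hX, isLTC_starCode_hZ hn hZ', exists_heavy_X_generators hp hw,
    hZ, exists_heavy_qubits hw, colWeight_starCode_hX_le hw⟩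

end
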